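/- Let $\mathsf{RCA}_0^\omega$ be Kohlenbach's higher-order base theory: the classical theory in the language of all finite types (type $0$ for numbers, $\sigma\to\tau$ for functionals) with the successor axioms, the combinators $\Pi,\Sigma$, the recursor of type $0$, the axiom of extensionality in all types, induction for quantifier-free formulas, and $\mathsf{QF\text{-}AC}^{1,0}$. Let $\mathsf{ACA}_0^\omega$ be $\mathsf{RCA}_0^\omega$ together with $(\exists^2)$: there is $E:\mathbb N^{\mathbb N}\to\mathbb N$ such that for all $f\in\mathbb N^{\mathbb N}$, $E(f)=0\leftrightarrow(\exists n)(f(n)=0)$. In these theories reals are fast-converging Cauchy sequences of rationals, $f:[0,1]\to\mathbb R$ is a functional of type $1\to 1$ that maps reals in $[0,1]$ to reals and respects equality of reals, and subsets of $\mathbb R$ are given by characteristic functions $F:\mathbb R\to\{0,1\}$. Extended reals $\overline{\mathbb R}=\mathbb R\cup\{+\infty,-\infty\}$ are coded by objects of type $1$. Interior ($\mathrm{int}$) and closure (overline) are taken in the space $[0,1]$ and are shorthand for their defining formulas. A set $S\subset[0,1]$ is *semi-open* if $S\subset\overline{\mathrm{int}(S)}$, *semi-closed* if $\mathrm{int}(\overline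 S)\subset S$, an *$\alpha$-set* if $S\subset\mathrm{int}(\overline{\mathrm{int}(S)})$, *regular closed* if $S=\overline{\mathrm{int}(S)}$, an *$\mathcal A$-set* if $S=O\cap C$ with $O$ open and $C$ regular closed, and an *$\mathcal{AB}$-set* if $S=O\cap C$ with $O$ open and $C$ semi-open and semi-closed. A function $f:[0,1]\to\mathbb R$ is *s-continuous* (resp. *$\alpha$-*, *$\mathcal A$-*, *$\mathcal{AB}$-*, *contra-*, *SR-continuous*) if for every open $G\subset\mathbb R$ the set $f^{-1}(G)$ is semi-open (resp. an $\alpha$-set, an $\mathcal A$-set, an $\mathcal{AB}$-set, closed, semi-open and semi-closed). It is *quasi-continuous* if for all $x\in[0,1]$, $\varepsilon>0$ and every open neighbourhood $U$ of $x$ in $[0,1]$ there is a nonempty interval $(a,b)\subset U$ with $|f(x)-f(y)|<\varepsilon$ for all $y\in(a,b)$. **Theorem 2.7.** Let $\Gamma$ be the class of all $f:[0,1]\to\mathbb R$ that are $\alpha$-, s-, $\mathcal A$-, $\mathcal{AB}$-, quasi-, contra- or SR-continuous. The following is provable in $\mathsf{ACA}_0^\omega$ (equivalently, by completeness, true in every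 model of $\mathsf{ACA}_0^\omega$): there is a supremum functional for $\Gamma$, that is, a functional $\Xi$ from functions $[0,1]\to\mathbb R$ to $\overline{\mathbb R}$ such that for every $f$ in $\Gamma$, $\Xi(f)$ is the supremum of $f$ on $[0,1]$ (with value $+\infty$ if $f$ is unbounded above). Moreover, for every $f$ in $\Gamma$ and every real $q$, $$(\exists x\in[0,1])(f(x)>q)\leftrightarrow(\exists r\in\mathbb Q\cap[0,1])(f(r)>q).$$ -/

import Mathlib

universe u

/-! ### The language of finite types -/

/-- The finite types: `0` and `σ → τ`. -/
inductive FinType : Type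
  | o : FinType
  | arr : FinType → FinType → FinType
  deriving DecidableEq

namespace FinType

/-- The type `1 = 0 → 0`. -/
abbrev one : FinType := arr o o

/-- The type `2 = 1 → 0`. -/
abbrev two : FinType := arr one o

end FinType

open FinType in
/-- Typed terms: variables `x_n^σ`, the constants `0`, `S`, the combinators `Π` and `Σ`, the
recursor of type `0`, and application. -/
inductive FinTerm : FinType → Type
  | var (σ : FinType) (n : ℕ) : FinTerm σ
  | zero : FinTerm o
  | succ : FinTerm (arr o o)
  | combK (σ τ : FinType) : FinTerm (arr σ (arr τ σ))
  | combS (ρ σ τ : FinType) : FinTerm (arr (arr ρ (arr σ τ)) (arr (arr ρ σ) (arr ρ τ)))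
  | rec0 : FinTerm (arr (arr o (arr o o)) (arr o (arr o o)))
  | app {σ τ : FinType} : FinTerm (arr σ τ) → FinTerm σ → FinTerm τ

/-- Quantifier-free formulas; equality of type `0` is the only primitive relation. -/
inductive QFFormula : Type
  | eq0 : FinTerm FinType.o → FinTerm FinType.o → QFFormula
  | bot : QFFormula
  | imp : QFFormula → QFFormula → QFFormula
  | and : QFFormula → QFFormula → QFFormula
  | or : QFFormula → QFFormula → QFFormula

open FinType in
/-- A structure for the (many-sorted) language of finite types. The objects of type `0` may be
nonstandard numbers, and `carrier (arr σ τ)` need not contain all functions. Equality of type `0`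
is interpreted as identity. A sentence of the language is provable in one of the theories below if
and only if it is true in all structures satisfying its axioms. -/
structure TypeStructure where
  carrier : FinType → Type u
  app {σ τ : FinType} : carrier (arr σ τ) → carrier σ → carrier τ
  zero : carrier o
  succ : carrier (arr o o)
  combK (σ τ : FinType) : carrier (arr σ (arr τ σ))
  combS (ρ σ τ : FinType) : carrier (arr (arr ρ (arr σ τ)) (arr (arr ρ σ) (arr ρ τ)))
  rec0 : carrier (arr (arr o (arr o o)) (arr o (arr o o)))

namespace TypeStructure

open FinType

variable (M : TypeStructure.{u})

/-- Assignments of values to the variables. -/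
abbrev Assignment : Type u := (σ : FinType) → ℕ → M.carrier σ

/-- The assignment `v[x_n^σ := a]`. -/
def assign {M : TypeStructure.{u}} (v : M.Assignment) (σ : FinType) (n : ℕ) (a : M.carrier σ) :
    M.Assignment :=
  Function.update v σ (Function.update (v σ) n a)

/-- The value of a term. -/
def eval (v : M.Assignment) : {σ : FinType} → FinTerm σ → M.carrier σ
  | _, .var σ n => v σ n
  | _, .zero => M.zero
  | _, .succ => M.succ
  | _, .combK σ τ => M.combK σ τ
  | _, .combS ρ σ τ => M.combS ρ σ τ
  | _, .rec0 => M.rec0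
  | _, .app s t => M.app (eval v s) (eval v t)

/-- Satisfaction of a quantifier-free formula. -/
def Sat (v : M.Assignment) : QFFormula → Prop
  | .eq0 s t => M.eval v s = M.eval v t
  | .bot => False
  | .imp φ ψ => Sat v φ → Sat v ψ
  | .and φ ψ => Sat v φ ∧ Sat v ψ
  | .or φ ψ => Sat v φ ∨ Sat v ψ

/-- Defined (extensional) equality `=_σ` of type `σ`. -/
def Eqv : (σ : FinType) → M.carrier σ → M.carrier σ → Prop
  | .o, x, y => x = y
  | .arr σ τ, f, g => ∀ x : M.carrier σ, Eqv τ (M.app f x) (M.app g x)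

/-- `M` is a model of Kohlenbach's base theory `RCA₀^ω`, i.e. of `E-PRA^ω + QF-AC^{1,0}`. -/
structure ModelsRCA : Prop where
  succ_ne_zero : ∀ n, M.app M.succ n ≠ M.zero
  succ_inj : ∀ m n, M.app M.succ m = M.app M.succ n → m = n
  combK_eq : ∀ (σ τ : FinType) (x : M.carrier σ) (y : M.carrier τ),
    M.Eqv σ (M.app (M.app (M.combK σ τ) x) y) x
  combS_eq : ∀ (ρ σ τ : FinType) (f : M.carrier (arr ρ (arr σ τ))) (g : M.carrier (arr ρ σ))
    (x : M.carrier ρ),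
    M.Eqv τ (M.app (M.app (M.app (M.combS ρ σ τ) f) g) x) (M.app (M.app f x) (M.app g x))
  rec0_zero : ∀ (f : M.carrier (arr o (arr o o))) (m : M.carrier o),
    M.app (M.app (M.app M.rec0 f) m) M.zero = m
  rec0_succ : ∀ (f : M.carrier (arr o (arr o o))) (m n : M.carrier o),
    M.app (M.app (M.app M.rec0 f) m) (M.app M.succ n) =
      M.app (M.app f n) (M.app (M.app (M.app M.rec0 f) m) n)
  /-- The axiom of extensionality in all types. -/
  extensionality : ∀ (σ τ : FinType) (f : M.carrier (arr σ τ)) (x y : M.carrier σ),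
    M.Eqv σ x y → M.Eqv τ (M.app f x) (M.app f y)
  /-- Induction for quantifier-free formulas with parameters of arbitrary types. -/
  qf_induction : ∀ (φ : QFFormula) (i : ℕ) (v : M.Assignment),
    M.Sat (assign v o i M.zero) φ →
    (∀ n, M.Sat (assign v o i n) φ → M.Sat (assign v o i (M.app M.succ n)) φ) →
    ∀ n, M.Sat (assign v o i n) φ
  /-- `QF-AC^{1,0}`: `∀ f^1 ∃ n^0 φ(f, n) → ∃ F^2 ∀ f^1 φ(f, F(f))` for quantifier-free `φ` with
  parameters of arbitrary types. -/
  qf_choice : ∀ (φ : QFFormula) (i j : ℕ) (v : M.Assignment),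
    (∀ f : M.carrier one, ∃ n : M.carrier o, M.Sat (assign (assign v one i f) o j n) φ) →
    ∃ F : M.carrier two, ∀ f : M.carrier one,
      M.Sat (assign (assign v one i f) o j (M.app F f)) φ

/-- `M` is a model of `ACA₀^ω`, i.e. of `RCA₀^ω` together with Kleene's quantifier axiom `(∃²)`. -/
structure ModelsACA : Prop extends ModelsRCA M where
  exists_two : ∃ E : M.carrier two, ∀ f : M.carrier one,
    M.app E f = M.zero ↔ ∃ n : M.carrier o, M.app f n = M.zero

/-! ### Arithmetic inside a structure

All quantifiers below range over the carriers of the structure, so that every predicate is (the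
interpretation of) a formula of the language. -/

/-- Addition, by recursion on the second argument. -/
def addFn : M.carrier (arr o (arr o o)) :=
  M.app M.rec0 (M.app (M.combK (arr o o) o) M.succ)

def add (m n : M.carrier o) : M.carrier o := M.app (M.app M.addFn m) n

/-- Multiplication by `m`, by recursion: `m * 0 = 0` and `m * (n + 1) = m + m * n`. -/
def mulFn (m : M.carrier o) : M.carrier one :=
  M.app (M.app M.rec0 (M.app (M.combK (arr o o) o) (M.app M.addFn m))) M.zero

def mul (m n : M.carrier o) : M.carrier o := M.app (M.mulFn m) n

/-- The successor of `n`. -/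
def suc (n : M.carrier o) : M.carrier o := M.app M.succ n

def num1 : M.carrier o := M.suc M.zero

def num2 : M.carrier o := M.suc M.num1

/-- The power `2 ^ n`, by recursion. -/
def pow2 (n : M.carrier o) : M.carrier o :=
  M.app (M.app (M.app M.rec0 (M.app (M.combK (arr o o) o) (M.mulFn M.num2))) M.num1) n

def ltNat (m n : M.carrier o) : Prop := ∃ c : M.carrier o, M.add m (M.suc c) = n

/-- `p` is the Cantor pair of `m` and `n`: `2 p = (m + n) (m + n + 1) + 2 m`. -/
def IsPair (p m n : M.carrier o) : Prop :=
  M.add p p = M.add (M.mul (M.add m n) (M.suc (M.add m n))) (M.add m m)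

/-- Three numbers of type `0`, standing for the rational number `(pos - neg) / den`. -/
structure Frac (M : TypeStructure.{u}) where
  pos : M.carrier o
  neg : M.carrier o
  den : M.carrier o

/-- The code `q` of type `0`, a Cantor pair `⟨⟨a, b⟩, c⟩`, stands for the rational
`(a - b) / (c + 1)`. -/
def Codes (q : M.carrier o) (r : M.Frac) : Prop :=
  ∃ p c : M.carrier o, M.IsPair q p c ∧ M.IsPair p r.pos r.neg ∧ r.den = M.suc c

/-- Sum of fractions. -/
def fadd (r s : M.Frac) : M.Frac where
  pos := M.add (M.mul r.pos s.den) (M.mul s.pos r.den)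
  neg := M.add (M.mul r.neg s.den) (M.mul s.neg r.den)
  den := M.mul r.den s.den

/-- Order of fractions (with positive denominators). -/
def flt (r s : M.Frac) : Prop :=
  M.ltNat (M.add (M.mul r.pos s.den) (M.mul s.neg r.den))
    (M.add (M.mul s.pos r.den) (M.mul r.neg s.den))

/-- The fraction `2 ^ (-k)`. -/
def two_neg (k : M.carrier o) : M.Frac := ⟨M.num1, M.zero, M.pow2 k⟩

/-- The fraction `2 * 2 ^ (-k)`. -/
def two_two_neg (k : M.carrier o) : M.Frac := ⟨M.num2, M.zero, M.pow2 k⟩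

/-! ### Real numbers inside a structure -/

/-- Real numbers are fast-converging Cauchy sequences of (codes of) rationals:
`|x_n - x_{n+i}| < 2 ^ (-n)` for all `n, i`. -/
def IsReal (x : M.carrier one) : Prop :=
  ∀ n i : M.carrier o, ∃ r s : M.Frac, M.Codes (M.app x n) r ∧ M.Codes (M.app x (M.add n i)) s ∧
    M.flt r (M.fadd s (M.two_neg n)) ∧ M.flt s (M.fadd r (M.two_neg n))

/-- `x <_ℝ y`: there is `n` with `x_n + 2 * 2 ^ (-n) < y_n`. -/
def rlt (x y : M.carrier one) : Prop :=
  ∃ (n : M.carrier o) (r s : M.Frac), M.Codes (M.app x n) r ∧ M.Codes (M.app y n) s ∧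
    M.flt (M.fadd r (M.two_two_neg n)) s

def rle (x y : M.carrier one) : Prop := ¬ M.rlt y x

def req (x y : M.carrier one) : Prop := M.rle x y ∧ M.rle y x

/-- `|x - y| < 2 ^ (-k)` for real numbers: there is `n` with
`|x_n - y_n| + 2 * 2 ^ (-n) < 2 ^ (-k)`. -/
def near (k : M.carrier o) (x y : M.carrier one) : Prop :=
  ∃ (n : M.carrier o) (r s : M.Frac), M.Codes (M.app x n) r ∧ M.Codes (M.app y n) s ∧
    M.flt (M.fadd r (M.two_two_neg n)) (M.fadd s (M.two_neg k)) ∧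
    M.flt (M.fadd s (M.two_two_neg n)) (M.fadd r (M.two_neg k))

/-- The rational with code `q` as a real number, namely as a constant sequence. -/
def ratReal (q : M.carrier o) : M.carrier one := M.app (M.combK o o) q

/-- `x` is a real number with `0 ≤ x` and `x ≤ 1`. -/
def Unit01 (x : M.carrier one) : Prop :=
  M.IsReal x ∧
    (∃ q : M.carrier o, M.Codes q ⟨M.zero, M.zero, M.num1⟩ ∧ M.rle (M.ratReal q) x) ∧
    ∃ q : M.carrier o, M.Codes q ⟨M.num1, M.zero, M.num1⟩ ∧ M.rle x (M.ratReal q)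

/-- `f` is a function `[0,1] → ℝ`: it maps reals in `[0,1]` to reals and respects `=_ℝ`. -/
def IsFun01 (f : M.carrier (arr one one)) : Prop :=
  (∀ x, M.Unit01 x → M.IsReal (M.app f x)) ∧
    ∀ x y, M.Unit01 x → M.Unit01 y → M.req x y → M.req (M.app f x) (M.app f y)

/-! ### Sets of reals and topology

Sets are given by characteristic functions. The interior and closure of a set need not exist as
characteristic functions; they are used as shorthand, that is, as predicates. Topological notions
are relative to a space `X`, which is `ℝ` or `[0,1]`. -/

/-- `A` is (the characteristic function of) a subset of `ℝ`. -/
def IsSet (A : M.carrier two) : Prop :=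
  (∀ x, M.IsReal x → M.app A x = M.zero ∨ M.app A x = M.num1) ∧
    ∀ x y, M.IsReal x → M.IsReal y → M.req x y → M.app A x = M.app A y

/-- Membership in a set given by its characteristic function. -/
def Mem (A : M.carrier two) (x : M.carrier one) : Prop := M.app A x = M.num1

/-- `P` is open in `X`. -/
def OpenIn (X P : M.carrier one → Prop) : Prop :=
  ∀ x, X x → P x → ∃ k : M.carrier o, ∀ y, X y → M.near k x y → P y

/-- `P` is closed in `X`. -/
def ClosedIn (X P : M.carrier one → Prop) : Prop := M.OpenIn X fun x => ¬ P x

/-- The interior of `P` in `X`. -/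
def Int (X P : M.carrier one → Prop) (x : M.carrier one) : Prop :=
  X x ∧ ∃ k : M.carrier o, ∀ y, X y → M.near k x y → P y

/-- The closure of `P` in `X`. -/
def Cl (X P : M.carrier one → Prop) (x : M.carrier one) : Prop :=
  X x ∧ ∀ k : M.carrier o, ∃ y, X y ∧ M.near k x y ∧ P y

def SemiOpen (X P : M.carrier one → Prop) : Prop := ∀ x, X x → P x → M.Cl X (M.Int X P) x

def SemiClosed (X P : M.carrier one → Prop) : Prop := ∀ x, X x → M.Int X (M.Cl X P) x → P x

def AlphaSet (X P : M.carrier one → Prop) : Prop :=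
  ∀ x, X x → P x → M.Int X (M.Cl X (M.Int X P)) x

def RegularClosed (X P : M.carrier one → Prop) : Prop :=
  ∀ x, X x → (P x ↔ M.Cl X (M.Int X P) x)

/-- `𝒜`-sets: intersections of an open and a regular closed set. -/
def ASet (X P : M.carrier one → Prop) : Prop :=
  ∃ O C : M.carrier two, M.IsSet O ∧ M.IsSet C ∧ M.OpenIn X (M.Mem O) ∧
    M.RegularClosed X (M.Mem C) ∧ ∀ x, X x → (P x ↔ M.Mem O x ∧ M.Mem C x)

/-- `𝒜ℬ`-sets: intersections of an open and a semi-open, semi-closed set. -/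
def ABSet (X P : M.carrier one → Prop) : Prop :=
  ∃ O C : M.carrier two, M.IsSet O ∧ M.IsSet C ∧ M.OpenIn X (M.Mem O) ∧
    M.SemiOpen X (M.Mem C) ∧ M.SemiClosed X (M.Mem C) ∧
    ∀ x, X x → (P x ↔ M.Mem O x ∧ M.Mem C x)

/-- `G` is an open subset of `ℝ`. -/
def IsOpenSet (G : M.carrier two) : Prop := M.IsSet G ∧ M.OpenIn M.IsReal (M.Mem G)

/-- The inverse image of `G` under `f : [0,1] → ℝ`. -/
def Preimage (f : M.carrier (arr one one)) (G : M.carrier two) (x : M.carrier one) : Prop :=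
  M.Unit01 x ∧ M.Mem G (M.app f x)

/-! ### Weak continuity notions for `f : [0,1] → ℝ` -/

def AlphaContinuous (f : M.carrier (arr one one)) : Prop :=
  ∀ G, M.IsOpenSet G → M.AlphaSet M.Unit01 (M.Preimage f G)

def SContinuous (f : M.carrier (arr one one)) : Prop :=
  ∀ G, M.IsOpenSet G → M.SemiOpen M.Unit01 (M.Preimage f G)

def AContinuous (f : M.carrier (arr one one)) : Prop :=
  ∀ G, M.IsOpenSet G → M.ASet M.Unit01 (M.Preimage f G)

def ABContinuous (f : M.carrier (arr one one)) : Prop :=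
  ∀ G, M.IsOpenSet G → M.ABSet M.Unit01 (M.Preimage f G)

def ContraContinuous (f : M.carrier (arr one one)) : Prop :=
  ∀ G, M.IsOpenSet G → M.ClosedIn M.Unit01 (M.Preimage f G)

def SRContinuous (f : M.carrier (arr one one)) : Prop :=
  ∀ G, M.IsOpenSet G →
    M.SemiOpen M.Unit01 (M.Preimage f G) ∧ M.SemiClosed M.Unit01 (M.Preimage f G)

/-- For every `x` in `[0,1]`, every `ε = 2 ^ (-k)` and every open neighbourhood `U` of `x` in
`[0,1]` there is a nonempty interval `(a, b) ⊆ U` with `|f x - f y| < ε` for all `y ∈ (a, b)`. -/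
def QuasiContinuous (f : M.carrier (arr one one)) : Prop :=
  ∀ x, M.Unit01 x → ∀ (k : M.carrier o) (U : M.carrier two), M.IsSet U →
    M.OpenIn M.Unit01 (M.Mem U) → M.Mem U x →
    ∃ a b, M.Unit01 a ∧ M.Unit01 b ∧ M.rlt a b ∧
      ∀ y, M.IsReal y → M.rlt a y → M.rlt y b →
        M.Mem U y ∧ M.near k (M.app f x) (M.app f y)

/-- The functions `[0,1] → ℝ` satisfying one of the seven weak continuity notions. -/
def Tame (f : M.carrier (arr one one)) : Prop :=
  M.IsFun01 f ∧
    (M.AlphaContinuous f ∨ M.SContinuous f ∨ M.AContinuous f ∨ M.ABContinuous f ∨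
      M.QuasiContinuous f ∨ M.ContraContinuous f ∨ M.SRContinuous f)

/-! ### Extended reals and suprema

An extended real is coded by an object `h` of type `1`: it is `+∞` if `h 0 = 1`, it is `-∞` if
`h 0 = 2`, and it is the real `h 1, h 2, …` if `h 0 = 0`. -/

/-- The sequence `h 1, h 2, …`. -/
def tail (h : M.carrier one) : M.carrier one :=
  M.app (M.app (M.combS o o o) (M.app (M.combK one o) h)) M.succ

def IsExtReal (h : M.carrier one) : Prop :=
  (M.app h M.zero = M.zero ∧ M.IsReal (M.tail h)) ∨ M.app h M.zero = M.num1 ∨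
    M.app h M.zero = M.num2

/-- Equality of extended reals. -/
def extEq (h h' : M.carrier one) : Prop :=
  M.app h M.zero = M.app h' M.zero ∧
    (M.app h M.zero = M.zero → M.req (M.tail h) (M.tail h'))

/-- `x ≤ h` for a real `x` and an extended real `h`. -/
def leExt (x h : M.carrier one) : Prop :=
  M.app h M.zero = M.num1 ∨ (M.app h M.zero = M.zero ∧ M.rle x (M.tail h))

/-- `x < h` for a real `x` and an extended real `h`. -/
def ltExt (x h : M.carrier one) : Prop :=
  M.app h M.zero = M.num1 ∨ (M.app h M.zero = M.zero ∧ M.rlt x (M.tail h))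

/-- The extended real `h` is the supremum of `f` on `[0,1]`: it is an upper bound, and no smaller
real is an upper bound. -/
def IsSup01 (f : M.carrier (arr one one)) (h : M.carrier one) : Prop :=
  M.IsExtReal h ∧ (∀ x, M.Unit01 x → M.leExt (M.app f x) h) ∧
    ∀ z, M.IsReal z → M.ltExt z h → ∃ x, M.Unit01 x ∧ M.rlt z (M.app f x)

/-- `Ξ` maps functions `[0,1] → ℝ` to extended reals, and functions that are equal on `[0,1]` to
equal extended reals. -/
def IsExtFunctional (Ξ : M.carrier (arr (arr one one) one)) : Prop :=
  (∀ f, M.IsFun01 f → M.IsExtReal (M.app Ξ f)) ∧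
    ∀ f g, M.IsFun01 f → M.IsFun01 g →
      (∀ x, M.Unit01 x → M.req (M.app f x) (M.app g x)) → M.extEq (M.app Ξ f) (M.app Ξ g)

/-- `Ξ` is a supremum functional for the class `Γ` of functions `[0,1] → ℝ`. -/
def IsSupFunctional (Γ : M.carrier (arr one one) → Prop)
    (Ξ : M.carrier (arr (arr one one) one)) : Prop :=
  M.IsExtFunctional Ξ ∧ ∀ f, Γ f → M.IsSup01 f (M.app Ξ f)

end TypeStructure

set_option linter.unusedSectionVars false

namespace TypeStructure

open FinType

/-! ### Definability with parameters -/

section Definability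

variable {M : TypeStructure.{u}}

theorem Eqv.refl : ∀ {σ : FinType} (x : M.carrier σ), M.Eqv σ x x
  | .o, _ => rfl
  | .arr _ _, f => fun x => Eqv.refl (M.app f x)

theorem Eqv.symm : ∀ {σ : FinType} {x y : M.carrier σ}, M.Eqv σ x y → M.Eqv σ y x
  | .o, _, _, h => Eq.symm h
  | .arr _ _, _, _, h => fun x => Eqv.symm (h x)

theorem Eqv.trans : ∀ {σ : FinType} {x y z : M.carrier σ},
    M.Eqv σ x y → M.Eqv σ y z → M.Eqv σ x z
  | .o, _, _, _, h, h' => Eq.trans h h'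
  | .arr _ _, _, _, _, h, h' => fun x => Eqv.trans (h x) (h' x)

variable [hM : Fact M.ModelsACA]

theorem Eqv.app {σ τ : FinType} {f g : M.carrier (arr σ τ)} {x y : M.carrier σ}
    (h : M.Eqv _ f g) (h' : M.Eqv _ x y) : M.Eqv τ (M.app f x) (M.app g y) :=
  (h x).trans (hM.out.extensionality σ τ g x y h')

/-- Contexts: types of tuples of objects of `M`, together with the functions on them that are
given by closed terms with parameters, up to extensional equality. -/
class Ctx (M : TypeStructure.{u}) (α : Type u) where
  Rep : ∀ {τ : FinType}, (α → M.carrier τ) → Prop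
  const : ∀ {τ : FinType} (c : M.carrier τ), Rep fun _ => c
  app : ∀ {σ τ : FinType} {F : α → M.carrier (arr σ τ)} {G : α → M.carrier σ},
    Rep F → Rep G → Rep fun e => M.app (F e) (G e)

/-- With no variables, a function is a single object, and every object may serve as a parameter. -/
instance : Ctx M PUnit.{u + 1} where
  Rep _ := True
  const _ := trivial
  app _ _ := trivial

/-- Bracket abstraction: the new variable is removed by `combK` from constants and by `combS` from
applications. Equality is only extensional because the combinator axioms are, so the axiom of
extensionality is needed for applications. -/
instance {σ : FinType} {α : Type u} [Ctx M α] : Ctx M (M.carrier σ × α) where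
  Rep {τ} F := ∃ G : α → M.carrier (arr σ τ), Ctx.Rep G ∧
    ∀ x e, M.Eqv τ (M.app (G e) x) (F (x, e))
  const {τ} c := ⟨fun _ => M.app (M.combK τ σ) c, Ctx.const _,
    fun x _ => hM.out.combK_eq τ σ c x⟩
  app {ρ τ F G} := by
    rintro ⟨F', hF, hF'⟩ ⟨G', hG, hG'⟩
    refine ⟨fun e => M.app (M.app (M.combS σ ρ τ) (F' e)) (G' e),
      Ctx.app (Ctx.app (Ctx.const _) hF) hG, fun x e => ?_⟩
    exact (hM.out.combS_eq σ ρ τ _ _ x).trans (Eqv.app (hF' x e) (hG' x e))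

/-- `F` is given by a term with parameters. -/
def Rep {α : Type u} [Ctx M α] {τ : FinType} (F : α → M.carrier τ) : Prop := Ctx.Rep F

variable {α : Type u} [Ctx M α] {σ τ : FinType}

theorem Rep.const (c : M.carrier τ) : Rep (fun _ : α => c) := Ctx.const c

theorem Rep.app {F : α → M.carrier (arr σ τ)} {G : α → M.carrier σ} (hF : Rep F) (hG : Rep G) :
    Rep fun e => M.app (F e) (G e) := Ctx.app hF hG

theorem Rep.weaken {F : α → M.carrier τ} (hF : Rep F) :
    Rep fun e : M.carrier σ × α => F e.2 :=
  ⟨fun e => M.app (M.combK τ σ) (F e), Ctx.app (Ctx.const _) hF,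
    fun x e => hM.out.combK_eq τ σ (F e) x⟩

theorem Rep.fst : Rep fun e : M.carrier σ × α => e.1 :=
  ⟨fun _ => M.app (M.app (M.combS σ (arr σ σ) σ) (M.combK σ (arr σ σ))) (M.combK σ σ),
    Ctx.const _, fun x _ => (hM.out.combS_eq σ (arr σ σ) σ _ _ x).trans (hM.out.combK_eq _ _ _ _)⟩

theorem Rep.curry {F : M.carrier σ × α → M.carrier τ} (hF : Rep F) :
    ∃ G : α → M.carrier (arr σ τ), Rep G ∧ ∀ x e, M.Eqv τ (M.app (G e) x) (F (x, e)) := hF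

theorem Rep.exists_closed {F : M.carrier σ × PUnit.{u + 1} → M.carrier τ} (hF : Rep F) :
    ∃ t : M.carrier (arr σ τ), ∀ x, M.Eqv τ (M.app t x) (F (x, ⟨⟩)) :=
  let ⟨G, _, hG⟩ := hF.curry
  ⟨G ⟨⟩, fun x => hG x _⟩

/-- Bound variables are de Bruijn indices into nested pairs; this lemma and its successors are the
variable cases of `Dec.of_formula`. -/
theorem Rep.snd1 {σ₁ : FinType} : Rep fun e : M.carrier σ₁ × M.carrier σ × α => e.2.1 :=
  Rep.fst.weaken

theorem Rep.snd2 {σ₁ σ₂ : FinType} :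
    Rep fun e : M.carrier σ₁ × M.carrier σ₂ × M.carrier σ × α => e.2.2.1 :=
  Rep.snd1.weaken

theorem Rep.snd3 {σ₁ σ₂ σ₃ : FinType} :
    Rep fun e : M.carrier σ₁ × M.carrier σ₂ × M.carrier σ₃ × M.carrier σ × α => e.2.2.2.1 :=
  Rep.snd2.weaken

theorem Rep.snd4 {σ₁ σ₂ σ₃ σ₄ : FinType} :
    Rep fun e : M.carrier σ₁ × M.carrier σ₂ × M.carrier σ₃ × M.carrier σ₄ × M.carrier σ × α =>
      e.2.2.2.2.1 :=
  Rep.snd3.weaken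

theorem Rep.snd5 {σ₁ σ₂ σ₃ σ₄ σ₅ : FinType} :
    Rep fun e : M.carrier σ₁ × M.carrier σ₂ × M.carrier σ₃ × M.carrier σ₄ × M.carrier σ₅ ×
      M.carrier σ × α => e.2.2.2.2.2.1 :=
  Rep.snd4.weaken

theorem Rep.snd6 {σ₁ σ₂ σ₃ σ₄ σ₅ σ₆ : FinType} :
    Rep fun e : M.carrier σ₁ × M.carrier σ₂ × M.carrier σ₃ × M.carrier σ₄ × M.carrier σ₅ ×
      M.carrier σ₆ × M.carrier σ × α => e.2.2.2.2.2.2.1 :=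
  Rep.snd5.weaken

theorem Rep.snd7 {σ₁ σ₂ σ₃ σ₄ σ₅ σ₆ σ₇ : FinType} :
    Rep fun e : M.carrier σ₁ × M.carrier σ₂ × M.carrier σ₃ × M.carrier σ₄ × M.carrier σ₅ ×
      M.carrier σ₆ × M.carrier σ₇ × M.carrier σ × α => e.2.2.2.2.2.2.2.1 :=
  Rep.snd6.weaken

theorem Rep.snd8 {σ₁ σ₂ σ₃ σ₄ σ₅ σ₆ σ₇ σ₈ : FinType} :
    Rep fun e : M.carrier σ₁ × M.carrier σ₂ × M.carrier σ₃ × M.carrier σ₄ × M.carrier σ₅ ×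
      M.carrier σ₆ × M.carrier σ₇ × M.carrier σ₈ × M.carrier σ × α => e.2.2.2.2.2.2.2.2.1 :=
  Rep.snd7.weaken

/-- The number `n` is sent to the sequence `a, b, b, …`. -/
theorem exists_seq (a b : α → M.carrier o) (ha : Rep a) (hb : Rep b) :
    ∃ F : α → M.carrier one, Rep F ∧ ∀ e, M.app (F e) M.zero = a e ∧
      ∀ n, M.app (F e) (M.suc n) = b e := by
  refine ⟨fun e => M.app (M.app M.rec0 (M.app (M.combK (arr o o) o) (M.app (M.combK o o) (b e))))
    (a e), .app (.app (.const _) (.app (.const _) (.app (.const _) hb))) ha, fun e =>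
    ⟨hM.out.rec0_zero _ _, fun n => ?_⟩⟩
  refine (hM.out.rec0_succ _ _ n).trans ?_
  have h := hM.out.combK_eq (arr o o) o (M.app (M.combK o o) (b e)) n
  exact (h _).trans (hM.out.combK_eq o o _ _)

/-! ### Characteristic functionals, arithmetical comprehension, choice and induction -/

variable (M) in
/-- An object of each type. -/
def inhabitant : (σ : FinType) → M.carrier σ
  | .o => M.zero
  | .arr σ τ => M.app (M.combK τ σ) (inhabitant τ)

/-- Properties of sequences given by quantifier-free formulas have characteristic functionals. -/
theorem exists_char (φ : QFFormula) (P : M.carrier one → Prop) (hP : ∀ (v : M.Assignment) f n,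
    M.Sat (assign (assign v one 0 f) o 0 n) φ ↔ P f) :
    ∃ F : M.carrier two, ∀ f, M.app F f = M.zero ↔ P f := by
  -- The choice is forced: the value is `0` if `φ` holds and `1` otherwise.
  obtain ⟨F, hF⟩ := hM.out.qf_choice
    (.or (.and (.eq0 (.var o 0) .zero) φ)
      (.and (.eq0 (.var o 0) (.app .succ .zero)) (.imp φ .bot))) 0 0
    (fun σ _ => M.inhabitant σ) (fun f => by
      by_cases h : P f
      · exact ⟨M.zero, .inl ⟨by simp [Sat, eval, assign], (hP _ _ _).2 h⟩⟩
      · exact ⟨M.app M.succ M.zero, .inr ⟨by simp [Sat, eval, assign], fun h' => h ((hP _ _ _).1 h')⟩⟩)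
  refine ⟨F, fun f => ?_⟩
  have h := hF f
  simp only [Sat, hP, eval] at h
  simp only [assign, Function.update_self] at h
  rcases h with ⟨h, h'⟩ | ⟨h, h'⟩
  · simp [h, h']
  · simp only [h, hM.out.succ_ne_zero, false_iff]
    exact h'

/-- `P` has a characteristic function given by a term with parameters. -/
def Dec (P : α → Prop) : Prop := ∃ F : α → M.carrier o, Rep F ∧ ∀ e, F e = M.zero ↔ P e

-- Quantifier-free choice takes one argument of type `1`, so the two truth values are packed as the
-- first two entries of a sequence.
variable (M) in
theorem exists_char_imp : ∃ D : M.carrier two, ∀ f, M.app D f = M.zero ↔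
    (M.app f M.zero = M.zero → M.app f (M.suc M.zero) = M.zero) :=
  exists_char (.imp (.eq0 (.app (.var one 0) .zero) .zero)
    (.eq0 (.app (.var one 0) (.app .succ .zero)) .zero)) _ fun v f n => by
      simp [Sat, eval, assign, suc]

variable (M) in
theorem exists_char_eq : ∃ D : M.carrier two, ∀ f, M.app D f = M.zero ↔
    M.app f M.zero = M.app f (M.suc M.zero) :=
  exists_char (.eq0 (.app (.var one 0) .zero) (.app (.var one 0) (.app .succ .zero))) _
    fun v f n => by simp [Sat, eval, assign, suc]

theorem Dec.congr {P Q : α → Prop} (hP : Dec (M := M) P) (h : ∀ e, P e ↔ Q e) :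
    Dec (M := M) Q :=
  let ⟨F, hF, hFP⟩ := hP
  ⟨F, hF, fun e => (hFP e).trans (h e)⟩

theorem Dec.eq {F G : α → M.carrier o} (hF : Rep F) (hG : Rep G) :
    Dec (M := M) fun e => F e = G e := by
  obtain ⟨D, hD⟩ := exists_char_eq M
  obtain ⟨s, hs, h⟩ := exists_seq F G hF hG
  exact ⟨fun e => M.app D (s e), .app (.const D) hs, fun e => by rw [hD, (h e).1, (h e).2]⟩

theorem Dec.imp {P Q : α → Prop} (hP : Dec (M := M) P) (hQ : Dec (M := M) Q) :
    Dec (M := M) fun e => P e → Q e := by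
  obtain ⟨F, hF, hP⟩ := hP
  obtain ⟨G, hG, hQ⟩ := hQ
  obtain ⟨D, hD⟩ := exists_char_imp M
  obtain ⟨s, hs, h⟩ := exists_seq F G hF hG
  exact ⟨fun e => M.app D (s e), .app (.const D) hs, fun e => by
    rw [hD, (h e).1, (h e).2, hP, hQ]⟩

theorem Dec.false : Dec (M := M) fun _ : α => False :=
  ⟨fun _ => M.suc M.zero, .const _, fun _ => by simp [suc, hM.out.succ_ne_zero]⟩

theorem Dec.not {P : α → Prop} (hP : Dec (M := M) P) : Dec (M := M) fun e => ¬ P e :=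
  hP.imp .false

theorem Dec.or {P Q : α → Prop} (hP : Dec (M := M) P) (hQ : Dec (M := M) Q) :
    Dec (M := M) fun e => P e ∨ Q e :=
  (hP.not.imp hQ).congr fun _ => or_iff_not_imp_left.symm

theorem Dec.and {P Q : α → Prop} (hP : Dec (M := M) P) (hQ : Dec (M := M) Q) :
    Dec (M := M) fun e => P e ∧ Q e :=
  (hP.imp hQ.not).not.congr fun _ => by tauto

/-- The functional of `∃²` is applied to the characteristic sequence of `Q e`, which is a term in
`e` by abstraction. -/
theorem Dec.exists {Q : α → M.carrier o → Prop}
    (hQ : Dec (M := M) fun e : M.carrier o × α => Q e.2 e.1) :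
    Dec (M := M) fun e => ∃ n, Q e n := by
  obtain ⟨F, hF, hQ⟩ := hQ
  obtain ⟨E, hE⟩ := hM.out.exists_two
  obtain ⟨G, hG, hGF⟩ := hF.curry
  refine ⟨fun e => M.app E (G e), .app (.const _) hG, fun e => (hE _).trans ?_⟩
  refine exists_congr fun n => ?_
  rw [show M.app (G e) n = F (n, e) from hGF n e, hQ]

theorem Dec.forall {Q : α → M.carrier o → Prop}
    (hQ : Dec (M := M) fun e : M.carrier o × α => Q e.2 e.1) :
    Dec (M := M) fun e => ∀ n, Q e n :=
  (Dec.exists (Q := fun e n => ¬ Q e n) hQ.not).not.congr fun _ => by simp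

theorem Dec.exists_frac {Q : α → M.Frac → Prop}
    (hQ : Dec (M := M) fun e : M.carrier o × M.carrier o × M.carrier o × α =>
      Q e.2.2.2 ⟨e.1, e.2.1, e.2.2.1⟩) :
    Dec (M := M) fun e => ∃ r, Q e r :=
  (Dec.exists (Q := fun e c => ∃ b a, Q e ⟨a, b, c⟩)
    (Dec.exists (Q := fun (e : M.carrier o × α) b => ∃ a, Q e.2 ⟨a, b, e.1⟩)
      (Dec.exists (Q := fun (e : M.carrier o × M.carrier o × α) a =>
        Q e.2.2 ⟨a, e.1, e.2.1⟩) hQ))).congr fun _ =>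
    ⟨fun ⟨_, _, _, h⟩ => ⟨_, h⟩, fun ⟨r, h⟩ => ⟨r.den, r.neg, r.pos, h⟩⟩

variable (M) in
/-- Feferman's search operator. -/
theorem exists_search : ∃ μ : M.carrier two, ∀ f : M.carrier one, ∀ n, M.app f n = M.zero →
    M.app f (M.app μ f) = M.zero := by
  obtain ⟨E, hE⟩ := hM.out.exists_two
  -- With `E` as a parameter, `E f = 0 → f n = 0` is quantifier-free, and for each `f` some `n`
  -- satisfies it.
  obtain ⟨F, hF⟩ := hM.out.qf_choice
    (.imp (.eq0 (.app (.var two 1) (.var one 0)) .zero)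
      (.eq0 (.app (.var one 0) (.var o 0)) .zero)) 0 0
    (assign (fun σ _ => M.inhabitant σ) two 1 E) (fun f => by
      by_cases h : ∃ n, M.app f n = M.zero
      · obtain ⟨n, h⟩ := h
        exact ⟨n, fun _ => by simpa [Sat, eval, assign] using h⟩
      · refine ⟨M.zero, fun h' => absurd ((hE f).1 ?_) h⟩
        simpa [Sat, eval, assign] using h')
  refine ⟨F, fun f n hn => ?_⟩
  have h := hF f
  simp only [Sat, eval, assign] at h
  simpa using h (by simpa using (hE f).2 ⟨n, hn⟩)

/-- The search operator acts on the characteristic sequence of `Q e`, so the choice depends on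
parameters `e` of all types, beyond what `QF-AC^{1,0}` gives directly. If no `n` works, the value is
irrelevant. -/
theorem Dec.exists_choice {Q : α → M.carrier o → Prop}
    (hQ : Dec (M := M) fun e : M.carrier o × α => Q e.2 e.1) :
    ∃ F : α → M.carrier o, Rep F ∧ ∀ e n, Q e n → Q e (F e) := by
  obtain ⟨F, hF, hQ⟩ := hQ
  obtain ⟨μ, hμ⟩ := exists_search M
  obtain ⟨G, hG, hGF⟩ := hF.curry
  have hGF' : ∀ n e, M.app (G e) n = M.zero ↔ Q e n := fun n e => by
    rw [show M.app (G e) n = F (n, e) from hGF n e, hQ]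
  exact ⟨fun e => M.app μ (G e), .app (.const _) hG, fun e n h =>
    (hGF' _ _).1 (hμ _ n ((hGF' _ _).2 h))⟩

/-- Sets given by definable predicates exist. -/
theorem Dec.exists_set {P : M.carrier one → Prop}
    (hP : Dec (M := M) fun e : M.carrier one × PUnit.{u + 1} => P e.1) :
    ∃ G : M.carrier two, ∀ x, (M.app G x = M.zero ∨ M.app G x = M.num1) ∧ (M.Mem G x ↔ P x) := by
  -- Characteristic terms signal truth by `0`, sets signal membership by `1`; choosing the
  -- prescribed value converts one into the other.
  have h : Dec (M := M) fun e : M.carrier o × M.carrier one × PUnit.{u + 1} =>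
      (P e.2.1 → e.1 = M.num1) ∧ (¬ P e.2.1 → e.1 = M.zero) := by
    obtain ⟨F, hF, hFP⟩ := hP
    have h : Dec (M := M) fun e : M.carrier o × M.carrier one × PUnit.{u + 1} => P e.2.1 :=
      ⟨fun e => F e.2, hF.weaken, fun e => hFP e.2⟩
    refine (h.imp ?_).and (h.not.imp ?_)
    all_goals exact .eq .fst (.const _)
  obtain ⟨F, hF, hF'⟩ := Dec.exists_choice (Q := fun (e : M.carrier one × PUnit.{u + 1}) n =>
    (P e.1 → n = M.num1) ∧ (¬ P e.1 → n = M.zero)) h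
  obtain ⟨G, hG⟩ := hF.exists_closed
  have h0 : M.num1 ≠ M.zero := hM.out.succ_ne_zero _
  refine ⟨G, fun x => ?_⟩
  have hx : M.app G x = F (x, ⟨⟩) := hG x
  unfold Mem
  by_cases h : P x
  · have := (hF' (x, ⟨⟩) M.num1 (by simp [h])).1 h
    simp [hx, this, h]
  · have := (hF' (x, ⟨⟩) M.zero (by simp [h])).2 h
    simp [hx, this, h, h0.symm]

/-- Induction for arithmetical formulas. -/
theorem Dec.induction {P : M.carrier o → Prop}
    (hP : Dec (M := M) fun e : M.carrier o × PUnit.{u + 1} => P e.1) (h0 : P M.zero)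
    (hs : ∀ n, P n → P (M.suc n)) (n : M.carrier o) : P n := by
  obtain ⟨F, hF, hFP⟩ := hP
  obtain ⟨G, hG⟩ := hF.exists_closed
  have h : ∀ n, M.Sat (assign (assign (fun σ _ => M.inhabitant σ) one 0 G) o 0 n)
      (.eq0 (.app (.var one 0) (.var o 0)) .zero) ↔ P n := fun n => by
    have : M.app G n = F (n, ⟨⟩) := hG n
    simp [Sat, eval, assign, this, hFP]
  exact (h n).1 (hM.out.qf_induction _ 0 _ ((h _).2 h0) (fun n hn => (h _).2 (hs n ((h n).1 hn))) n)

end Definability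

end TypeStructure

/-! ### The ordered field of fractions of a semiring of natural numbers -/

section DifferenceRing

/-- Commutative semirings that are the set of nonnegative elements of an ordered domain. -/
class NonnegSemiring (R : Type*) [CommSemiring R] : Prop where
  add_left_cancel : ∀ a b c : R, a + b = a + c → b = c
  total : ∀ a b : R, ∃ c, a + c = b ∨ b + c = a
  eq_zero_of_add : ∀ a b : R, a + b = 0 → a = 0
  eq_zero_of_mul : ∀ a b : R, a * b = 0 → a = 0 ∨ b = 0
  one_ne_zero : (1 : R) ≠ 0

variable (R : Type*) [CommSemiring R] [hR : NonnegSemiring R]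

/-- Formal differences `a.re - a.im` are identified when they are equal. -/
def differenceCon : RingCon (QuadraticAlgebra R 1 0) where
  r x y := x.re + y.im = y.re + x.im
  iseqv := ⟨fun _ => rfl, Eq.symm, fun {x y z} h h' =>
    hR.add_left_cancel y.im _ _ <| by
      rw [show y.im + (x.re + z.im) = x.re + y.im + z.im by ring, h,
        show y.re + x.im + z.im = y.re + z.im + x.im by ring, h']
      ring⟩
  add' {w x y z} h h' := by
    simp only [QuadraticAlgebra.re_add, QuadraticAlgebra.im_add]
    rw [add_add_add_comm, h, h', add_add_add_comm]
  mul' {w x y z} h h' := by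
    simp only [QuadraticAlgebra.re_mul, QuadraticAlgebra.im_mul, one_mul, zero_mul, add_zero]
    -- The adjoined element squares to `1`, so it multiplies like `-1`. With these mixed terms
    -- added, `h` and `h'` can each be used without subtraction.
    apply hR.add_left_cancel (x.re * y.im + x.im * y.re)
    calc _ = (w.re + x.im) * y.re + (x.re + w.im) * y.im + (x.re * z.im + x.im * z.re) := by ring
      _ = (x.re + w.im) * y.re + (w.re + x.im) * y.im + (x.re * z.im + x.im * z.re) := by rw [h]
      _ = x.re * (y.re + z.im) + x.im * (z.re + y.im) + (w.re * y.im + w.im * y.re) := by ring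
      _ = x.re * (z.re + y.im) + x.im * (y.re + z.im) + (w.re * y.im + w.im * y.re) := by rw [h']
      _ = _ := by ring

/-- The ring of differences of elements of `R`. -/
def DifferenceRing : Type _ := (differenceCon R).Quotient

namespace DifferenceRing

variable {R}

/-- The difference `a - b`. -/
def mk (a b : R) : DifferenceRing R := ((⟨a, b⟩ : QuadraticAlgebra R 1 0) : (differenceCon R).Quotient)

theorem mk_eq_mk {a b c d : R} : mk a b = mk c d ↔ a + d = c + b :=
  (differenceCon R).eq

theorem exists_mk (z : DifferenceRing R) : ∃ a b, z = mk a b := by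
  induction z using Quotient.inductionOn with
  | h x => exact ⟨x.re, x.im, rfl⟩

instance : CommSemiring (DifferenceRing R) := inferInstanceAs (CommSemiring (differenceCon R).Quotient)

theorem mk_add (a b c d : R) : mk a b + mk c d = mk (a + c) (b + d) := rfl

theorem mk_mul (a b c d : R) : mk a b * mk c d = mk (a * c + b * d) (a * d + b * c) := by
  refine (show mk a b * mk c d = mk (a * c + 1 * b * d) (a * d + b * c + 0 * b * d) from rfl).trans ?_
  simp

instance : Neg (DifferenceRing R) where
  neg := Quotient.map' (fun x => ⟨x.im, x.re⟩) fun x y (h : x.re + y.im = y.re + x.im) => by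
    change x.im + y.re = y.im + x.re
    rw [add_comm, ← h, add_comm]

instance : CommRing (DifferenceRing R) where
  zsmul := zsmulRec
  neg_add_cancel z := by
    obtain ⟨a, b, rfl⟩ := exists_mk z
    change mk b a + mk a b = mk 0 0
    rw [mk_add, mk_eq_mk]
    ring
  mul_comm := mul_comm

variable (R) in
/-- The inclusion of the nonnegative elements. -/
def incl : R →+* DifferenceRing R where
  toFun a := mk a 0
  map_zero' := rfl
  map_one' := rfl
  map_add' a b := by simp [mk_add]
  map_mul' a b := by simp [mk_mul]

theorem incl_injective : Function.Injective (incl R) := fun a b h => by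
  simpa using mk_eq_mk.1 h

theorem exists_incl (z : DifferenceRing R) : ∃ a, z = incl R a ∨ z = -incl R a := by
  obtain ⟨a, b, rfl⟩ := exists_mk z
  obtain ⟨c, h | h⟩ := hR.total a b
  · exact ⟨c, .inr (mk_eq_mk.2 (by simp [h]))⟩
  · exact ⟨c, .inl (mk_eq_mk.2 (by simp [← h, add_comm]))⟩

/-- Up to sign every element comes from `R`, which has no zero divisors. -/
instance : IsDomain (DifferenceRing R) :=
  haveI : Nontrivial (DifferenceRing R) :=
    ⟨0, 1, fun h => hR.one_ne_zero (incl_injective (by simpa using h.symm))⟩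
  haveI : NoZeroDivisors (DifferenceRing R) := ⟨fun {x y} h => by
    obtain ⟨a, ha⟩ := exists_incl x
    obtain ⟨b, hb⟩ := exists_incl y
    have h' : incl R (a * b) = 0 := by
      rw [map_mul]
      rcases ha with rfl | rfl <;> rcases hb with rfl | rfl <;> simpa using h
    have := hR.eq_zero_of_mul a b (incl_injective (by simpa using h'))
    rcases this with rfl | rfl
    · left; simpa using ha
    · right; simpa using hb⟩
  NoZeroDivisors.to_isDomain _

end DifferenceRing

/-- The field of fractions of elements of `R` and of their negatives. -/
abbrev FracField : Type _ := FractionRing (DifferenceRing R)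

namespace FracField

/-- The inclusion of the nonnegative elements. -/
noncomputable def ofNat : R →+* FracField R :=
  (algebraMap (DifferenceRing R) (FracField R)).comp (DifferenceRing.incl R)

variable {R}

theorem ofNat_injective : Function.Injective (ofNat R) :=
  (IsFractionRing.injective (DifferenceRing R) (FracField R)).comp DifferenceRing.incl_injective

theorem exists_div (x : FracField R) :
    ∃ a b : R, b ≠ 0 ∧ (x = ofNat R a / ofNat R b ∨ -x = ofNat R a / ofNat R b) := by
  obtain ⟨z, w, hw, rfl⟩ := IsFractionRing.div_surjective (A := DifferenceRing R) x
  have hw := nonZeroDivisors.ne_zero hw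
  obtain ⟨a, ha⟩ := DifferenceRing.exists_incl z
  obtain ⟨b, hb⟩ := DifferenceRing.exists_incl w
  refine ⟨a, b, fun h => hw (by simpa [h] using hb), ?_⟩
  rcases ha with rfl | rfl <;> rcases hb with rfl | rfl <;> simp [ofNat, neg_div, div_neg]

variable (R) in
/-- The cone of nonnegative fractions. -/
noncomputable def cone : RingCone (FracField R) where
  -- The case `b = 0` is harmless: the quotient is then `0`.
  carrier := {x | ∃ a b : R, x = ofNat R a / ofNat R b}
  zero_mem' := ⟨0, 1, by simp⟩
  one_mem' := ⟨1, 1, by simp⟩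
  add_mem' := by
    rintro _ _ ⟨a, b, rfl⟩ ⟨c, d, rfl⟩
    by_cases hb : ofNat R b = 0
    · exact ⟨c, d, by simp [hb]⟩
    by_cases hd : ofNat R d = 0
    · exact ⟨a, b, by simp [hd]⟩
    exact ⟨a * d + b * c, b * d, by simp [div_add_div _ _ hb hd]⟩
  mul_mem' := by
    rintro _ _ ⟨a, b, rfl⟩ ⟨c, d, rfl⟩
    exact ⟨a * c, b * d, by simp [div_mul_div_comm]⟩
  eq_zero_of_mem_of_neg_mem' := by
    rintro _ ⟨a, b, rfl⟩ ⟨c, d, h⟩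
    by_cases hb : ofNat R b = 0
    · simp [hb]
    by_cases hd : ofNat R d = 0
    · simpa [hd] using h
    have h' : ofNat R (a * d + b * c) = 0 := by
      rw [← neg_div, div_eq_div_iff hb hd] at h
      rw [map_add, map_mul, map_mul]
      linear_combination -h
    have := hR.eq_zero_of_add _ _ (ofNat_injective (h'.trans (map_zero _).symm))
    rcases hR.eq_zero_of_mul _ _ this with h0 | h0
    · simp [h0]
    · simp [h0] at hd

theorem mem_cone {x : FracField R} : x ∈ cone R ↔ ∃ a b : R, x = ofNat R a / ofNat R b := Iff.rfl

instance : HasMemOrNegMem (cone R) where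
  mem_or_neg_mem x :=
    let ⟨a, b, _, h⟩ := exists_div x
    h.imp (fun h => ⟨a, b, h⟩) fun h => ⟨a, b, h⟩

open Classical in
noncomputable instance : LinearOrder (FracField R) := .mkOfAddGroupCone (cone R)

instance : IsStrictOrderedRing (FracField R) :=
  haveI : IsOrderedRing (FracField R) := IsOrderedRing.mkOfCone (cone R)
  IsOrderedRing.toIsStrictOrderedRing _

theorem nonneg_iff {x : FracField R} : 0 ≤ x ↔ ∃ a b : R, x = ofNat R a / ofNat R b := by
  change x - 0 ∈ cone R ↔ _
  rw [sub_zero, mem_cone]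

theorem ofNat_nonneg (a : R) : 0 ≤ ofNat R a := nonneg_iff.2 ⟨a, 1, by simp⟩

theorem ofNat_eq_zero {a : R} : ofNat R a = 0 ↔ a = 0 := map_eq_zero_iff _ ofNat_injective

theorem ofNat_le {a b : R} : ofNat R a ≤ ofNat R b ↔ ∃ c, a + c = b := by
  constructor
  · intro h
    obtain ⟨c, hc | hc⟩ := hR.total a b
    · exact ⟨c, hc⟩
    · subst hc
      rw [map_add] at h
      have : ofNat R c = 0 := le_antisymm (by linarith) (ofNat_nonneg c)
      exact ⟨0, by simp [ofNat_eq_zero.1 this]⟩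
  · rintro ⟨c, rfl⟩
    rw [map_add]
    linarith [ofNat_nonneg c]

end FracField

end DifferenceRing

namespace TypeStructure

open FinType

/-! ### The numbers of the model as an ordered semiring -/

section Arithmetic

variable {M : TypeStructure.{u}} [hM : Fact M.ModelsACA] {α : Type u} [Ctx M α]

/-- A predicate that is written as an arithmetical formula is definable. -/
theorem Dec.of_formula {P : α → Prop} (hP : Dec (M := M) P := by
    repeat' first
      | assumption | exact Rep.fst | exact Rep.snd1 | exact Rep.snd2 | exact Rep.snd3
      | exact Rep.snd4 | exact Rep.snd5 | exact Rep.snd6 | exact Rep.snd7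
      | exact Rep.snd8
      | apply Rep.const | apply Rep.app | exact Dec.false | apply Dec.eq | apply Dec.and
      | apply Dec.or | apply Dec.not | apply Dec.imp | apply Dec.exists | apply Dec.forall
      | apply Dec.exists_frac) : Dec (M := M) P := hP

theorem add_zero' (m : M.carrier o) : M.add m M.zero = m := hM.out.rec0_zero _ _

theorem rec0_const_suc (f : M.carrier one) (m n : M.carrier o) :
    M.app (M.app (M.app M.rec0 (M.app (M.combK (arr o o) o) f)) m) (M.suc n) =
      M.app f (M.app (M.app (M.app M.rec0 (M.app (M.combK (arr o o) o) f)) m) n) :=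
  (hM.out.rec0_succ _ _ n).trans (hM.out.combK_eq (arr o o) o f n _)

theorem add_suc (m n : M.carrier o) : M.add m (M.suc n) = M.suc (M.add m n) :=
  rec0_const_suc _ _ _

theorem mul_zero' (m : M.carrier o) : M.mul m M.zero = M.zero := hM.out.rec0_zero _ _

theorem mul_suc (m n : M.carrier o) : M.mul m (M.suc n) = M.add m (M.mul m n) :=
  rec0_const_suc _ _ _

theorem pow2_zero : M.pow2 M.zero = M.num1 := hM.out.rec0_zero _ _

theorem pow2_suc (n : M.carrier o) : M.pow2 (M.suc n) = M.mul M.num2 (M.pow2 n) :=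
  rec0_const_suc _ _ _

theorem suc_ne_zero (n : M.carrier o) : M.suc n ≠ M.zero := hM.out.succ_ne_zero n

theorem suc_inj {m n : M.carrier o} : M.suc m = M.suc n ↔ m = n :=
  ⟨hM.out.succ_inj m n, congrArg _⟩

theorem zero_or_suc (n : M.carrier o) : n = M.zero ∨ ∃ m, n = M.suc m := by
  induction n using Dec.induction (M := M) with
  | hP => exact Dec.of_formula
  | h0 => exact .inl rfl
  | hs n _ => exact .inr ⟨n, rfl⟩

theorem zero_add' (n : M.carrier o) : M.add M.zero n = n := by
  induction n using Dec.induction (M := M) with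
  | hP => exact Dec.of_formula
  | h0 => exact add_zero' _
  | hs n ih => rw [add_suc, ih]

theorem suc_add (m n : M.carrier o) : M.add (M.suc m) n = M.suc (M.add m n) := by
  induction n using Dec.induction (M := M) with
  | hP => exact Dec.of_formula
  | h0 => rw [add_zero', add_zero']
  | hs n ih => rw [add_suc, ih, add_suc]

theorem add_comm' (m n : M.carrier o) : M.add m n = M.add n m := by
  induction n using Dec.induction (M := M) with
  | hP => exact Dec.of_formula
  | h0 => rw [add_zero', zero_add']
  | hs n ih => rw [add_suc, ih, suc_add]

theorem add_assoc' (a b c : M.carrier o) : M.add (M.add a b) c = M.add a (M.add b c) := by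
  induction c using Dec.induction (M := M) with
  | hP => exact Dec.of_formula
  | h0 => rw [add_zero', add_zero']
  | hs c ih => rw [add_suc, add_suc, add_suc, ih]

theorem add_right_cancel' (a b c : M.carrier o) : M.add b a = M.add c a → b = c := by
  induction a using Dec.induction (M := M) with
  | hP => exact Dec.of_formula
  | h0 => rw [add_zero', add_zero']; exact id
  | hs a ih => rw [add_suc, add_suc, suc_inj]; exact ih

theorem zero_mul' (n : M.carrier o) : M.mul M.zero n = M.zero := by
  induction n using Dec.induction (M := M) with
  | hP => exact Dec.of_formula
  | h0 => exact mul_zero' _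
  | hs n ih => rw [mul_suc, ih, zero_add']

theorem suc_mul (m n : M.carrier o) : M.mul (M.suc m) n = M.add n (M.mul m n) := by
  induction n using Dec.induction (M := M) with
  | hP => exact Dec.of_formula
  | h0 => rw [mul_zero', mul_zero', add_zero']
  | hs n ih =>
    rw [mul_suc, ih, mul_suc, suc_add, suc_add, ← add_assoc', ← add_assoc', add_comm' m n]

theorem mul_comm' (m n : M.carrier o) : M.mul m n = M.mul n m := by
  induction n using Dec.induction (M := M) with
  | hP => exact Dec.of_formula
  | h0 => rw [mul_zero', zero_mul']
  | hs n ih => rw [mul_suc, ih, suc_mul]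

theorem mul_add' (a b c : M.carrier o) : M.mul a (M.add b c) = M.add (M.mul a b) (M.mul a c) := by
  induction c using Dec.induction (M := M) with
  | hP => exact Dec.of_formula
  | h0 => rw [mul_zero', add_zero', add_zero']
  | hs c ih =>
    rw [add_suc, mul_suc, ih, mul_suc, ← add_assoc', ← add_assoc', add_comm' a]

theorem mul_assoc' (a b c : M.carrier o) : M.mul (M.mul a b) c = M.mul a (M.mul b c) := by
  induction c using Dec.induction (M := M) with
  | hP => exact Dec.of_formula
  | h0 => rw [mul_zero', mul_zero', mul_zero']
  | hs c ih => rw [mul_suc, mul_suc, ih, mul_add']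

theorem one_mul' (a : M.carrier o) : M.mul M.num1 a = a := by
  rw [num1, suc_mul, zero_mul', add_zero']

instance : Zero (M.carrier o) := ⟨M.zero⟩

instance : One (M.carrier o) := ⟨M.num1⟩

instance : Add (M.carrier o) := ⟨M.add⟩

instance : Mul (M.carrier o) := ⟨M.mul⟩

instance : CommSemiring (M.carrier o) where
  nsmul := nsmulRec
  npow := npowRec
  add_assoc := add_assoc'
  zero_add := zero_add'
  add_zero := add_zero'
  add_comm := add_comm'
  mul_assoc := mul_assoc'
  one_mul := one_mul'
  mul_one a := (mul_comm' a _).trans (one_mul' a)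
  mul_comm := mul_comm'
  zero_mul := zero_mul'
  mul_zero := mul_zero'
  left_distrib := mul_add'
  right_distrib a b c := by
    change M.mul (M.add a b) c = M.add (M.mul a c) (M.mul b c)
    rw [mul_comm', mul_add', mul_comm' c, mul_comm' c]

theorem zero_eq : M.zero = 0 := rfl

theorem num1_eq : M.num1 = 1 := rfl

theorem add_eq (m n : M.carrier o) : M.add m n = m + n := rfl

theorem mul_eq (m n : M.carrier o) : M.mul m n = m * n := rfl

theorem suc_eq (n : M.carrier o) : M.suc n = n + 1 := by
  change _ = M.add n (M.suc M.zero)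
  rw [add_suc, add_zero']

theorem num2_eq : M.num2 = 2 := by rw [num2, suc_eq, num1_eq, one_add_one_eq_two]

theorem exists_add_eq (a b : M.carrier o) : ∃ c, M.add a c = b ∨ M.add b c = a := by
  induction a using Dec.induction (M := M) with
  | hP => exact Dec.of_formula
  | h0 => exact ⟨b, .inl (zero_add' b)⟩
  | hs a ih =>
    obtain ⟨c, h | h⟩ := ih
    · obtain rfl | ⟨c, rfl⟩ := zero_or_suc c
      · exact ⟨M.num1, .inr (by rw [← h, add_zero', num1, add_suc, add_zero'])⟩
      · exact ⟨c, .inl (by rw [← h, suc_add, add_suc])⟩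
    · exact ⟨M.suc c, .inr (by rw [add_suc, h])⟩

instance : NonnegSemiring (M.carrier o) where
  add_left_cancel a b c h := add_right_cancel' a b c <| by
    rwa [add_comm' b, add_comm' c]
  total := exists_add_eq
  eq_zero_of_add a b h := by
    obtain rfl | ⟨b, rfl⟩ := zero_or_suc b
    · exact (add_zero' a).symm.trans h
    · exact absurd ((add_suc a b).symm.trans h) (suc_ne_zero _)
  eq_zero_of_mul a b h := by
    obtain rfl | ⟨a, rfl⟩ := zero_or_suc a
    · exact .inl rfl
    obtain rfl | ⟨b, rfl⟩ := zero_or_suc b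
    · exact .inr rfl
    · refine absurd (Eq.trans ?_ h) (suc_ne_zero (M.add a (M.mul (M.suc a) b)))
      rw [← mul_eq, mul_suc, suc_add]
  one_ne_zero := suc_ne_zero _

end Arithmetic

/-! ### Coded rationals and their values in the ordered field -/

section Rationals

variable {M : TypeStructure.{u}} [hM : Fact M.ModelsACA]

/-- The value of a number in the ordered field of fractions. -/
noncomputable abbrev toK (n : M.carrier o) : FracField (M.carrier o) := FracField.ofNat _ n

theorem toK_nonneg (n : M.carrier o) : 0 ≤ toK n := FracField.ofNat_nonneg n

theorem toK_inj {m n : M.carrier o} : toK m = toK n ↔ m = n := FracField.ofNat_injective.eq_iff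

theorem toK_eq_zero {n : M.carrier o} : toK n = 0 ↔ n = 0 := FracField.ofNat_eq_zero

theorem toK_pos {n : M.carrier o} (h : n ≠ 0) : 0 < toK n :=
  lt_of_le_of_ne (toK_nonneg n) fun h' => h (toK_eq_zero.1 h'.symm)

theorem toK_le {m n : M.carrier o} : toK m ≤ toK n ↔ ∃ c, m + c = n := FracField.ofNat_le

theorem ltNat_iff {m n : M.carrier o} : M.ltNat m n ↔ toK m < toK n := by
  constructor
  · rintro ⟨c, rfl⟩
    rw [add_eq, suc_eq]
    simp only [toK, map_add, map_one]
    linarith [toK_nonneg c]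
  · intro h
    obtain ⟨c, hc⟩ := toK_le.1 h.le
    obtain rfl | ⟨c, rfl⟩ := zero_or_suc c
    · rw [zero_eq, add_zero] at hc
      exact absurd (congrArg toK hc) h.ne
    · exact ⟨c, hc⟩

theorem toK_add_one_le {m n : M.carrier o} (h : toK m < toK n) : toK m + 1 ≤ toK n := by
  obtain ⟨c, rfl⟩ := ltNat_iff.2 h
  rw [add_eq, suc_eq]
  simp only [toK, map_add, map_one]
  linarith [toK_nonneg c]

theorem isPair_iff {p m n : M.carrier o} :
    M.IsPair p m n ↔ p + p = (m + n) * ((m + n) + 1) + (m + m) := by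
  unfold IsPair
  rw [suc_eq]
  rfl

/-- Induction along the antidiagonals: `(m, n + 1)` is followed by `(m + 1, n)`, and `(m, 0)` by
`(0, m + 1)`. -/
theorem exists_isPair_left (p : M.carrier o) : ∃ m n, M.IsPair p m n := by
  induction p using Dec.induction (M := M) with
  | hP => exact Dec.of_formula
  | h0 => exact ⟨0, 0, isPair_iff.2 (by simp [zero_eq])⟩
  | hs p ih =>
    obtain ⟨m, n, h⟩ := ih
    rw [isPair_iff] at h
    simp only [isPair_iff, suc_eq]
    have h' : p + 1 + (p + 1) = (m + n) * ((m + n) + 1) + (m + m) + 2 := by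
      rw [← h]; ring
    obtain rfl | ⟨n, rfl⟩ := zero_or_suc n
    · exact ⟨0, m + 1, by rw [h', zero_eq]; ring⟩
    · exact ⟨m + 1, n, by rw [h', suc_eq]; ring⟩

theorem exists_isPair (m n : M.carrier o) : ∃ p, M.IsPair p m n := by
  -- The doubled equation defining pairs can be halved because `s (s + 1)` is even.
  have h (s : M.carrier o) : ∃ t, M.add t t = M.mul s (M.suc s) := by
    induction s using Dec.induction (M := M) with
    | hP => exact Dec.of_formula
    | h0 => exact ⟨M.zero, by rw [zero_mul', add_zero']⟩
    | hs s ih =>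
      obtain ⟨t, ht⟩ := ih
      simp only [add_eq, mul_eq, suc_eq] at ht ⊢
      exact ⟨t + s + 1, by rw [show t + s + 1 + (t + s + 1) = (t + t) + 2 * s + 2 by ring, ht]; ring⟩
  obtain ⟨t, ht⟩ := h (m + n)
  simp only [add_eq, mul_eq, suc_eq] at ht
  refine ⟨t + m, isPair_iff.2 ?_⟩
  rw [← ht]
  ring

theorem IsPair.unique {p m n m' n' : M.carrier o} (h : M.IsPair p m n) (h' : M.IsPair p m' n') :
    m = m' ∧ n = n' := by
  -- A code on the antidiagonal `s = m + n` has double at most `s (s + 1) + 2 s`, less than `(s + 1)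
  -- (s + 2)`, where the next antidiagonal starts.
  have key {m n m' n' : M.carrier o} (h : M.IsPair p m n) (h' : M.IsPair p m' n') :
      ¬ toK (m + n) < toK (m' + n') := fun hlt => by
    have := toK_add_one_le hlt
    have e := congrArg toK ((isPair_iff.1 h).symm.trans (isPair_iff.1 h'))
    simp only [toK, map_add, map_mul, map_one] at e this
    have := toK_nonneg m
    have := toK_nonneg n
    have := toK_nonneg m'
    have := toK_nonneg n'
    simp only [toK] at *
    nlinarith
  have hs : toK (m + n) = toK (m' + n') := le_antisymm (not_lt.1 (key h' h)) (not_lt.1 (key h h'))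
  have e := congrArg toK ((isPair_iff.1 h).symm.trans (isPair_iff.1 h'))
  rw [toK_inj.1 hs] at e
  simp only [toK, map_add, map_mul, map_one] at e hs
  have hm : toK m = toK m' := by simp only [toK]; linarith
  refine ⟨toK_inj.1 hm, toK_inj.1 ?_⟩
  simp only [toK] at hm ⊢
  linarith

/-- The value of a fraction. -/
noncomputable def Frac.val (r : M.Frac) : FracField (M.carrier o) :=
  (toK r.pos - toK r.neg) / toK r.den

theorem Frac.val_fadd {r s : M.Frac} (hr : r.den ≠ 0) (hs : s.den ≠ 0) :
    (M.fadd r s).val = r.val + s.val := by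
  have h1 := (toK_pos hr).ne'
  have h2 := (toK_pos hs).ne'
  simp only [Frac.val, fadd, add_eq, mul_eq]
  simp only [toK, map_add, map_mul] at *
  field_simp
  ring

theorem Frac.den_fadd {r s : M.Frac} (hr : r.den ≠ 0) (hs : s.den ≠ 0) : (M.fadd r s).den ≠ 0 :=
  fun h => (NonnegSemiring.eq_zero_of_mul _ _ h).elim hr hs

theorem flt_iff {r s : M.Frac} (hr : r.den ≠ 0) (hs : s.den ≠ 0) :
    M.flt r s ↔ r.val < s.val := by
  have h1 := toK_pos hr
  have h2 := toK_pos hs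
  simp only [Frac.val, flt, add_eq, mul_eq, ltNat_iff]
  rw [div_lt_div_iff₀ h1 h2]
  simp only [toK, map_add, map_mul] at *
  constructor <;> intro h <;> linarith

theorem Codes.den_ne_zero {q : M.carrier o} {r : M.Frac} (h : M.Codes q r) : r.den ≠ 0 := by
  obtain ⟨p, c, -, -, h⟩ := h
  exact h ▸ suc_ne_zero c

theorem exists_codes (q : M.carrier o) : ∃ r, M.Codes q r := by
  obtain ⟨p, c, h⟩ := exists_isPair_left q
  obtain ⟨a, b, h'⟩ := exists_isPair_left p
  exact ⟨⟨a, b, M.suc c⟩, p, c, h, h', rfl⟩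

theorem exists_code (r : M.Frac) (hr : r.den ≠ 0) : ∃ q, M.Codes q r := by
  obtain h | ⟨c, hc⟩ := zero_or_suc r.den
  · exact absurd h hr
  obtain ⟨p, hp⟩ := exists_isPair r.pos r.neg
  obtain ⟨q, hq⟩ := exists_isPair p c
  exact ⟨q, p, c, hq, hp, hc⟩

theorem Codes.unique {q : M.carrier o} {r s : M.Frac} (h : M.Codes q r) (h' : M.Codes q s) :
    r = s := by
  obtain ⟨p, c, h1, h2, h3⟩ := h
  obtain ⟨p', c', h1', h2', h3'⟩ := h'
  obtain ⟨rfl, rfl⟩ := h1.unique h1'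
  cases r; cases s
  obtain ⟨rfl, rfl⟩ := h2.unique h2'
  simp_all

/-- The rational with code `q`. -/
noncomputable def ratVal (q : M.carrier o) : FracField (M.carrier o) := (exists_codes q).choose.val

theorem Codes.ratVal_eq {q : M.carrier o} {r : M.Frac} (h : M.Codes q r) : ratVal q = r.val := by
  rw [ratVal, (exists_codes q).choose_spec.unique h]

/-- The field consists exactly of the rationals of the model, so quantifying over it amounts to
quantifying over numbers. -/
theorem exists_ratVal_eq (x : FracField (M.carrier o)) : ∃ q, ratVal q = x := by
  obtain ⟨a, b, hb, h | h⟩ := FracField.exists_div x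
  · obtain ⟨q, hq⟩ := exists_code ⟨a, 0, b⟩ hb
    exact ⟨q, by rw [hq.ratVal_eq, h]; simp [Frac.val]⟩
  · obtain ⟨q, hq⟩ := exists_code ⟨0, a, b⟩ hb
    exact ⟨q, by rw [hq.ratVal_eq, ← neg_neg x, h]; simp [Frac.val, neg_div]⟩

/-- Every number codes exactly one fraction, so the existential quantifiers in the definitions on
reals disappear in favour of values. -/
theorem exists_codes_and {a b : M.carrier o} {P : M.Frac → M.Frac → Prop}
    {P' : FracField (M.carrier o) → FracField (M.carrier o) → Prop}
    (h : ∀ r s : M.Frac, r.den ≠ 0 → s.den ≠ 0 → (P r s ↔ P' r.val s.val)) :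
    (∃ r s, M.Codes a r ∧ M.Codes b s ∧ P r s) ↔ P' (ratVal a) (ratVal b) := by
  constructor
  · rintro ⟨r, s, hr, hs, hP⟩
    rw [hr.ratVal_eq, hs.ratVal_eq]
    exact (h r s hr.den_ne_zero hs.den_ne_zero).1 hP
  · intro hP
    obtain ⟨r, hr⟩ := exists_codes a
    obtain ⟨s, hs⟩ := exists_codes b
    rw [hr.ratVal_eq, hs.ratVal_eq] at hP
    exact ⟨r, s, hr, hs, (h r s hr.den_ne_zero hs.den_ne_zero).2 hP⟩

/-- The rational `2 ^ (-n)`. -/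
noncomputable def tw (n : M.carrier o) : FracField (M.carrier o) := (toK (M.pow2 n))⁻¹

theorem lt_pow2 (n : M.carrier o) : M.ltNat n (M.pow2 n) := by
  induction n using Dec.induction (M := M) with
  | hP => exact Dec.of_formula
  | h0 =>
    rw [ltNat_iff, pow2_zero, zero_eq, num1_eq]
    simp [toK]
  | hs n ih =>
    have h := toK_add_one_le (ltNat_iff.1 ih)
    rw [ltNat_iff, pow2_suc, suc_eq, mul_eq, num2_eq]
    simp only [toK, map_add, map_mul, map_one, map_ofNat] at *
    linarith [toK_nonneg n]

theorem toK_lt_pow2 (n : M.carrier o) : toK n < toK (M.pow2 n) := ltNat_iff.1 (lt_pow2 n)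

theorem toK_pow2_pos (n : M.carrier o) : 0 < toK (M.pow2 n) :=
  (toK_nonneg n).trans_lt (toK_lt_pow2 n)

theorem pow2_ne_zero (n : M.carrier o) : M.pow2 n ≠ 0 := fun h =>
  (toK_pow2_pos n).ne' (toK_eq_zero.2 h)

theorem tw_pos (n : M.carrier o) : 0 < tw n := inv_pos.2 (toK_pow2_pos n)

theorem val_two_neg (n : M.carrier o) : (M.two_neg n).val = tw n := by
  simp [Frac.val, two_neg, tw, zero_eq, num1_eq]

theorem val_two_two_neg (n : M.carrier o) : (M.two_two_neg n).val = 2 * tw n := by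
  simp [Frac.val, two_two_neg, tw, zero_eq, num2_eq, div_eq_mul_inv, map_ofNat, toK]

theorem pow2_le_pow2_add (n m : M.carrier o) :
    ∃ c, M.add (M.pow2 n) c = M.pow2 (M.add n m) := by
  induction m using Dec.induction (M := M) with
  | hP => exact Dec.of_formula
  | h0 => exact ⟨M.zero, by rw [add_zero', add_zero']⟩
  | hs m ih =>
    obtain ⟨c, hc⟩ := ih
    refine ⟨c + M.pow2 (M.add n m), ?_⟩
    rw [add_suc, pow2_suc, mul_eq, num2_eq, two_mul]
    nth_rw 2 [← hc]
    simp only [add_eq]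
    ring

theorem tw_add_le (n m : M.carrier o) : tw (n + m) ≤ tw n :=
  (inv_le_inv₀ (toK_pow2_pos _) (toK_pow2_pos _)).2 (toK_le.2 (pow2_le_pow2_add n m))

theorem tw_add_le' (n m : M.carrier o) : tw (n + m) ≤ tw m := add_comm n m ▸ tw_add_le m n

/-- The Archimedean property relative to the numbers of the model; the field may contain elements
infinitesimal over the standard numbers. For `x = a / b` the exponent `b` works, since `b < 2 ^ b`
and `1 ≤ a`. -/
theorem exists_tw_lt {x : FracField (M.carrier o)} (hx : 0 < x) : ∃ n, tw n < x := by
  obtain ⟨a, b, hb, h | h⟩ := FracField.exists_div x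
  · have ha : a ≠ 0 := by
      rintro rfl
      simp [h] at hx
    have ha : 1 ≤ toK a := by
      have := toK_add_one_le (m := 0) (n := a) (by simpa [toK] using toK_pos ha)
      simpa [toK] using this
    refine ⟨b, lt_of_lt_of_le ((inv_lt_inv₀ (toK_pow2_pos b) (toK_pos hb)).2 (toK_lt_pow2 b)) ?_⟩
    rw [h, div_eq_mul_inv]
    exact le_mul_of_one_le_left (inv_pos.2 (toK_pos hb)).le ha
  · have := div_nonneg (toK_nonneg a) (toK_nonneg b)
    simp only [toK] at this
    linarith

end Rationals

/-! ### Real numbers as cuts in the field -/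

section Reals

variable {M : TypeStructure.{u}} [hM : Fact M.ModelsACA]

theorem isReal_iff {x : M.carrier one} : M.IsReal x ↔
    ∀ n i, |ratVal (M.app x n) - ratVal (M.app x (n + i))| < tw n := by
  refine forall_congr' fun n => forall_congr' fun i => ?_
  refine exists_codes_and (P' := fun a b => |a - b| < tw n) fun r s hr hs => ?_
  have hn : (M.two_neg n).den ≠ 0 := pow2_ne_zero n
  rw [flt_iff hr (Frac.den_fadd hs hn), flt_iff hs (Frac.den_fadd hr hn), Frac.val_fadd hs hn,
    Frac.val_fadd hr hn, val_two_neg, abs_lt]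
  constructor <;> rintro ⟨h, h'⟩ <;> constructor <;> linarith

theorem rlt_iff {x y : M.carrier one} : M.rlt x y ↔
    ∃ n, ratVal (M.app x n) + 2 * tw n < ratVal (M.app y n) := by
  refine exists_congr fun n => ?_
  refine exists_codes_and (P' := fun a b => a + 2 * tw n < b) fun r s hr hs => ?_
  have hn : (M.two_two_neg n).den ≠ 0 := pow2_ne_zero n
  rw [flt_iff (Frac.den_fadd hr hn) hs, Frac.val_fadd hr hn, val_two_two_neg]

theorem near_iff {k : M.carrier o} {x y : M.carrier one} : M.near k x y ↔
    ∃ n, |ratVal (M.app x n) - ratVal (M.app y n)| + 2 * tw n < tw k := by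
  refine exists_congr fun n => ?_
  refine exists_codes_and (P' := fun a b => |a - b| + 2 * tw n < tw k) fun r s hr hs => ?_
  have hn : (M.two_two_neg n).den ≠ 0 := pow2_ne_zero n
  have hk : (M.two_neg k).den ≠ 0 := pow2_ne_zero k
  rw [flt_iff (Frac.den_fadd hr hn) (Frac.den_fadd hs hk),
    flt_iff (Frac.den_fadd hs hn) (Frac.den_fadd hr hk), Frac.val_fadd hr hn, Frac.val_fadd hs hn,
    Frac.val_fadd hr hk, Frac.val_fadd hs hk, val_two_two_neg, val_two_neg,
    show |r.val - s.val| + 2 * tw n < tw k ↔ |r.val - s.val| < tw k - 2 * tw n from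
      lt_sub_iff_add_lt.symm, abs_lt]
  constructor <;> rintro ⟨h, h'⟩ <;> constructor <;> linarith

/-- The fraction `c` is smaller than the real `x`. -/
def RatLT (c : FracField (M.carrier o)) (x : M.carrier one) : Prop :=
  ∃ n, c + tw n < ratVal (M.app x n)

/-- The real `x` is smaller than the fraction `c`. -/
def LTRat (x : M.carrier one) (c : FracField (M.carrier o)) : Prop :=
  ∃ n, ratVal (M.app x n) + tw n < c

variable {x y z : M.carrier one} {c d : FracField (M.carrier o)} {k n : M.carrier o}

theorem IsReal.abs_sub_lt (hx : M.IsReal x) (m n : M.carrier o) :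
    |ratVal (M.app x m) - ratVal (M.app x n)| < tw m + tw n := by
  have h := isReal_iff.1 hx m n
  have h' := isReal_iff.1 hx n m
  rw [add_comm n m] at h'
  rw [abs_lt] at *
  constructor <;> linarith

theorem RatLT.mono (h : RatLT c x) (hd : d ≤ c) : RatLT d x :=
  let ⟨n, hn⟩ := h
  ⟨n, by linarith⟩

theorem LTRat.mono (h : LTRat x c) (hd : c ≤ d) : LTRat x d :=
  let ⟨n, hn⟩ := h
  ⟨n, by linarith⟩

theorem RatLT.exists_gt (h : RatLT c x) : ∃ d, c < d ∧ RatLT d x := by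
  obtain ⟨n, hn⟩ := h
  exact ⟨(c + (ratVal (M.app x n) - tw n)) / 2, by linarith, n, by linarith⟩

theorem LTRat.exists_lt (h : LTRat x c) : ∃ d, d < c ∧ LTRat x d := by
  obtain ⟨n, hn⟩ := h
  exact ⟨(c + (ratVal (M.app x n) + tw n)) / 2, by linarith, n, by linarith⟩

theorem RatLT.lt (hx : M.IsReal x) (h : RatLT c x) (h' : LTRat x d) : c < d := by
  obtain ⟨n, hn⟩ := h
  obtain ⟨m, hm⟩ := h'
  have := abs_lt.1 (hx.abs_sub_lt n m)
  linarith

/-- An entry with `2 * 2 ^ (-n) < d - c` decides; no convergence of `x` is needed. -/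
theorem ratLT_or_ltRat (x : M.carrier one) (h : c < d) : RatLT c x ∨ LTRat x d := by
  obtain ⟨n, hn⟩ := exists_tw_lt (half_pos (sub_pos.2 h))
  by_cases h' : c + tw n < ratVal (M.app x n)
  · exact .inl ⟨n, h'⟩
  · exact .inr ⟨n, by linarith⟩

theorem rlt_iff_exists (hx : M.IsReal x) (hy : M.IsReal y) :
    M.rlt x y ↔ ∃ c, LTRat x c ∧ RatLT c y := by
  rw [rlt_iff]
  constructor
  · rintro ⟨n, hn⟩
    exact ⟨(ratVal (M.app x n) + ratVal (M.app y n)) / 2, ⟨n, by linarith⟩, ⟨n, by linarith⟩⟩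
  · rintro ⟨c, ⟨m, hm⟩, ⟨l, hl⟩⟩
    -- The gap between the bounds known at `m` and `l` must exceed the margin `2 * 2 ^ (-n)` at a
    -- common index `n` beyond `m`, `l` and `i`.
    obtain ⟨i, hi⟩ := exists_tw_lt (x := (ratVal (M.app y l) - tw l -
      (ratVal (M.app x m) + tw m)) / 2) (by linarith)
    refine ⟨m + (l + i), ?_⟩
    have h1 := abs_lt.1 (isReal_iff.1 hx m (l + i))
    have h2 := abs_lt.1 (isReal_iff.1 hy l (m + i))
    rw [add_left_comm l] at h2
    have h3 := (tw_add_le' m (l + i)).trans (tw_add_le' l i)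
    linarith

theorem rlt_of_rlt_of_rle (hx : M.IsReal x) (hy : M.IsReal y) (hz : M.IsReal z)
    (h : M.rlt x y) (h' : M.rle y z) : M.rlt x z := by
  obtain ⟨c, hc, hc'⟩ := (rlt_iff_exists hx hy).1 h
  obtain ⟨d, hd, hd'⟩ := hc'.exists_gt
  refine (rlt_iff_exists hx hz).2 ⟨c, hc, (ratLT_or_ltRat z hd).resolve_right fun h => h' ?_⟩
  exact (rlt_iff_exists hz hy).2 ⟨d, h, hd'⟩

theorem rlt_of_rle_of_rlt (hx : M.IsReal x) (hy : M.IsReal y) (hz : M.IsReal z)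
    (h : M.rle x y) (h' : M.rlt y z) : M.rlt x z := by
  obtain ⟨c, hc, hc'⟩ := (rlt_iff_exists hy hz).1 h'
  obtain ⟨d, hd, hd'⟩ := hc.exists_lt
  refine (rlt_iff_exists hx hz).2 ⟨c, (ratLT_or_ltRat x hd).resolve_left fun h'' => h ?_, hc'⟩
  exact (rlt_iff_exists hy hx).2 ⟨d, hd', h''⟩

theorem rlt_congr {x' y' : M.carrier one} (hx : M.IsReal x) (hy : M.IsReal y) (hx' : M.IsReal x')
    (hy' : M.IsReal y') (h : M.req x x') (h' : M.req y y') : M.rlt x y ↔ M.rlt x' y' :=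
  ⟨fun hh => rlt_of_rle_of_rlt hx' hx hy' h.2 (rlt_of_rlt_of_rle hx hy hy' hh h'.1),
    fun hh => rlt_of_rle_of_rlt hx hx' hy h.1 (rlt_of_rlt_of_rle hx' hy' hy hh h'.2)⟩

theorem not_rlt_self (hx : M.IsReal x) : ¬ M.rlt x x := fun h =>
  let ⟨_, h1, h2⟩ := (rlt_iff_exists hx hx).1 h
  lt_irrefl _ (h2.lt hx h1)

theorem near_self (k : M.carrier o) (x : M.carrier one) : M.near k x x := by
  obtain ⟨n, hn⟩ := exists_tw_lt (half_pos (tw_pos k))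
  exact near_iff.2 ⟨n, by rw [sub_self, abs_zero]; linarith⟩

theorem near_left {k l : M.carrier o} (h : M.near (k + l) x y) : M.near k x y :=
  let ⟨n, hn⟩ := near_iff.1 h
  near_iff.2 ⟨n, hn.trans_le (tw_add_le k l)⟩

theorem near_right {k l : M.carrier o} (h : M.near (k + l) x y) : M.near l x y :=
  near_left (add_comm k l ▸ h)

theorem RatLT.of_near (hx : M.IsReal x) (h : M.near k x y) (hc : RatLT c x) :
    RatLT (c - tw k) y := by
  obtain ⟨n, hn⟩ := near_iff.1 h
  obtain ⟨m, hm⟩ := hc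
  have h1 := abs_lt.1 (hx.abs_sub_lt n m)
  have h2 := abs_le.1 (show |ratVal (M.app x n) - ratVal (M.app y n)| ≤ tw k - 2 * tw n by
    linarith)
  exact ⟨n, by linarith⟩

theorem LTRat.of_near (hx : M.IsReal x) (h : M.near k x y) (hc : LTRat x c) :
    LTRat y (c + tw k) := by
  obtain ⟨n, hn⟩ := near_iff.1 h
  obtain ⟨m, hm⟩ := hc
  have h1 := abs_lt.1 (hx.abs_sub_lt n m)
  have h2 := abs_le.1 (show |ratVal (M.app x n) - ratVal (M.app y n)| ≤ tw k - 2 * tw n by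
    linarith)
  exact ⟨n, by linarith⟩

theorem exists_near_rlt_right (hx : M.IsReal x) (hy : M.IsReal y) (h : M.rlt x y) :
    ∃ k, ∀ z, M.IsReal z → M.near k y z → M.rlt x z := by
  obtain ⟨c, hc, hc'⟩ := (rlt_iff_exists hx hy).1 h
  obtain ⟨d, hd, hd'⟩ := hc'.exists_gt
  obtain ⟨k, hk⟩ := exists_tw_lt (sub_pos.2 hd)
  exact ⟨k, fun z hz hn => (rlt_iff_exists hx hz).2 ⟨c, hc, (hd'.of_near hy hn).mono
    (by linarith)⟩⟩

theorem exists_near_rlt_left (hx : M.IsReal x) (hy : M.IsReal y) (h : M.rlt x y) :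
    ∃ k, ∀ z, M.IsReal z → M.near k x z → M.rlt z y := by
  obtain ⟨c, hc, hc'⟩ := (rlt_iff_exists hx hy).1 h
  obtain ⟨d, hd, hd'⟩ := hc.exists_lt
  obtain ⟨k, hk⟩ := exists_tw_lt (sub_pos.2 hd)
  exact ⟨k, fun z hz hn => (rlt_iff_exists hz hy).2 ⟨c, (hd'.of_near hx hn).mono
    (by linarith), hc'⟩⟩

theorem app_ratReal (q n : M.carrier o) : M.app (M.ratReal q) n = q :=
  hM.out.combK_eq o o q n

theorem isReal_ratReal (q : M.carrier o) : M.IsReal (M.ratReal q) := isReal_iff.2 fun n i => by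
  simpa [app_ratReal] using tw_pos n

theorem ratLT_ratReal {q : M.carrier o} : RatLT c (M.ratReal q) ↔ c < ratVal q := by
  unfold RatLT
  simp only [app_ratReal]
  constructor
  · rintro ⟨n, hn⟩
    linarith [tw_pos n]
  · intro h
    obtain ⟨n, hn⟩ := exists_tw_lt (sub_pos.2 h)
    exact ⟨n, by linarith⟩

theorem ltRat_ratReal {q : M.carrier o} : LTRat (M.ratReal q) c ↔ ratVal q < c := by
  unfold LTRat
  simp only [app_ratReal]
  constructor
  · rintro ⟨n, hn⟩
    linarith [tw_pos n]
  · intro h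
    obtain ⟨n, hn⟩ := exists_tw_lt (sub_pos.2 h)
    exact ⟨n, by linarith⟩

theorem rlt_ratReal {q : M.carrier o} (hx : M.IsReal x) :
    M.rlt x (M.ratReal q) ↔ LTRat x (ratVal q) := by
  rw [rlt_iff_exists hx (isReal_ratReal q)]
  simp only [ratLT_ratReal]
  exact ⟨fun ⟨c, hc, h⟩ => hc.mono h.le, fun h => let ⟨d, hd, hd'⟩ := h.exists_lt; ⟨d, hd', hd⟩⟩

theorem ratReal_rlt {q : M.carrier o} (hx : M.IsReal x) :
    M.rlt (M.ratReal q) x ↔ RatLT (ratVal q) x := by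
  rw [rlt_iff_exists (isReal_ratReal q) hx]
  simp only [ltRat_ratReal]
  exact ⟨fun ⟨c, h, hc⟩ => hc.mono h.le, fun h => let ⟨d, hd, hd'⟩ := h.exists_gt; ⟨d, hd, hd'⟩⟩

theorem unit01_iff : M.Unit01 x ↔ M.IsReal x ∧ ¬ LTRat x 0 ∧ ¬ RatLT 1 x := by
  refine and_congr_right fun hx => and_congr ?_ ?_
  · have h {q} (hq : M.Codes q ⟨M.zero, M.zero, M.num1⟩) : ratVal q = 0 := by
      simp [hq.ratVal_eq, Frac.val]
    constructor
    · rintro ⟨q, hq, hle⟩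
      rwa [rle, rlt_ratReal hx, h hq] at hle
    · intro hle
      obtain ⟨q, hq⟩ := exists_code (⟨M.zero, M.zero, M.num1⟩ : M.Frac) (suc_ne_zero _)
      exact ⟨q, hq, by rwa [rle, rlt_ratReal hx, h hq]⟩
  · have h {q} (hq : M.Codes q ⟨M.num1, M.zero, M.num1⟩) : ratVal q = 1 := by
      simp [hq.ratVal_eq, Frac.val, num1_eq, zero_eq]
    constructor
    · rintro ⟨q, hq, hle⟩
      rwa [rle, ratReal_rlt hx, h hq] at hle
    · intro hle
      obtain ⟨q, hq⟩ := exists_code (⟨M.num1, M.zero, M.num1⟩ : M.Frac) (suc_ne_zero _)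
      exact ⟨q, hq, by rwa [rle, ratReal_rlt hx, h hq]⟩

theorem unit01_ratReal {q : M.carrier o} :
    M.Unit01 (M.ratReal q) ↔ 0 ≤ ratVal q ∧ ratVal q ≤ 1 := by
  rw [unit01_iff, ltRat_ratReal, ratLT_ratReal, not_lt, not_lt]
  exact and_iff_right (isReal_ratReal q)

/-- An entry of `x` is truncated to `[0,1]`, moving it by at most `2 ^ (-n)`; the margin in `near`
costs another `2 * 2 ^ (-n)`, hence the third of `tw k`. -/
theorem exists_ratReal_near (hx : M.Unit01 x) (k : M.carrier o) :
    ∃ r, M.Unit01 (M.ratReal r) ∧ M.near k x (M.ratReal r) := by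
  obtain ⟨hx, h0, h1⟩ := unit01_iff.1 hx
  obtain ⟨n, hn⟩ := exists_tw_lt (div_pos (tw_pos k) (zero_lt_three))
  obtain ⟨r, hr⟩ := exists_ratVal_eq (max 0 (min 1 (ratVal (M.app x n))))
  have h0' : 0 ≤ ratVal (M.app x n) + tw n := not_lt.1 fun h => h0 ⟨n, h⟩
  have h1' : ratVal (M.app x n) ≤ 1 + tw n := not_lt.1 fun h => h1 ⟨n, h⟩
  have htw := tw_pos n
  refine ⟨r, unit01_ratReal.2 ?_, near_iff.2 ⟨n, ?_⟩⟩
  · rw [hr]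
    exact ⟨le_max_left _ _, max_le zero_le_one (min_le_left _ _)⟩
  · rw [app_ratReal, hr]
    suffices |ratVal (M.app x n) - max 0 (min 1 (ratVal (M.app x n)))| ≤ tw n by linarith
    rw [abs_le]
    rcases le_total 1 (ratVal (M.app x n)) with h | h
    · rw [min_eq_left h, max_eq_right zero_le_one]
      constructor <;> linarith
    · rw [min_eq_right h]
      rcases le_total 0 (ratVal (M.app x n)) with h | h
      · rw [max_eq_right h]
        constructor <;> linarith
      · rw [max_eq_left h]
        constructor <;> linarith

theorem exists_ratReal_between (hx : M.Unit01 x) (hy : M.Unit01 y) (h : M.rlt x y) :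
    ∃ r, M.Unit01 (M.ratReal r) ∧ M.rlt x (M.ratReal r) ∧ M.rlt (M.ratReal r) y := by
  obtain ⟨hx, h0, -⟩ := unit01_iff.1 hx
  obtain ⟨hy, -, h1⟩ := unit01_iff.1 hy
  obtain ⟨c, hc, hc'⟩ := (rlt_iff_exists hx hy).1 h
  obtain ⟨r, rfl⟩ := exists_ratVal_eq c
  exact ⟨r, unit01_ratReal.2 ⟨not_lt.1 fun h => h0 (hc.mono h.le),
    not_lt.1 fun h => h1 (hc'.mono h.le)⟩, (rlt_ratReal hx).2 hc, (ratReal_rlt hy).2 hc'⟩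

end Reals

/-! ### From weak continuity to rational points -/

section WeakContinuity

variable {M : TypeStructure.{u}} [hM : Fact M.ModelsACA] {α : Type u} [Ctx M α]

theorem Dec.rlt {F G : α → M.carrier one} (hF : Rep F) (hG : Rep G) :
    Dec (M := M) fun e => M.rlt (F e) (G e) := by
  -- Nine bound numbers precede the parameters: the index, two fractions of three numbers, and the
  -- two witnesses in `Codes`.
  have hF : Rep fun e : M.carrier o × M.carrier o × M.carrier o × M.carrier o × M.carrier o ×
      M.carrier o × M.carrier o × M.carrier o × M.carrier o × α => F e.2.2.2.2.2.2.2.2.2 :=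
    hF.weaken.weaken.weaken.weaken.weaken.weaken.weaken.weaken.weaken
  have hG : Rep fun e : M.carrier o × M.carrier o × M.carrier o × M.carrier o × M.carrier o ×
      M.carrier o × M.carrier o × M.carrier o × M.carrier o × α => G e.2.2.2.2.2.2.2.2.2 :=
    hG.weaken.weaken.weaken.weaken.weaken.weaken.weaken.weaken.weaken
  exact Dec.of_formula

/-- The continuity notions speak only about open sets whose characteristic function exists in the
model, so each test set needs comprehension. -/
theorem exists_isOpenSet {P : M.carrier one → Prop}
    (hP : Dec (M := M) fun e : M.carrier one × PUnit.{u + 1} => P e.1)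
    (hreq : ∀ x y, M.IsReal x → M.IsReal y → M.req x y → (P x ↔ P y))
    (hopen : M.OpenIn M.IsReal P) : ∃ G, M.IsOpenSet G ∧ ∀ x, M.Mem G x ↔ P x := by
  obtain ⟨G, hG⟩ := hP.exists_set
  have h0 : M.zero ≠ M.num1 := (suc_ne_zero M.zero).symm
  refine ⟨G, ⟨⟨fun x _ => (hG x).1, fun x y hx hy h => ?_⟩, fun x hx h => ?_⟩, fun x => (hG x).2⟩
  · have h' := hreq x y hx hy h
    rw [← (hG x).2, ← (hG y).2] at h'
    unfold Mem at h'
    rcases (hG x).1 with hx | hx <;> rcases (hG y).1 with hy | hy <;> simp_all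
  · obtain ⟨k, hk⟩ := hopen x hx ((hG x).2.1 h)
    exact ⟨k, fun y hy hn => (hG y).2.2 (hk y hy hn)⟩

theorem exists_isOpenSet_gt {q : M.carrier one} (hq : M.IsReal q) :
    ∃ G, M.IsOpenSet G ∧ ∀ x, M.Mem G x ↔ M.rlt q x :=
  exists_isOpenSet (.rlt (.const q) .fst)
    (fun _ _ hx hy h => rlt_congr hq hx hq hy ⟨not_rlt_self hq, not_rlt_self hq⟩ h)
    fun _ hx h => exists_near_rlt_right hq hx h

theorem exists_isOpenSet_ne {q : M.carrier one} (hq : M.IsReal q) :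
    ∃ G, M.IsOpenSet G ∧ ∀ x, M.Mem G x ↔ M.rlt q x ∨ M.rlt x q := by
  have hqq : M.req q q := ⟨not_rlt_self hq, not_rlt_self hq⟩
  refine exists_isOpenSet (.or (.rlt (.const q) .fst) (.rlt .fst (.const q)))
    (fun x y hx hy h => or_congr (rlt_congr hq hx hq hy hqq h) (rlt_congr hx hq hy hq h hqq))
    fun x hx h => ?_
  rcases h with h | h
  · exact (exists_near_rlt_right hq hx h).imp fun k hk y hy hn => .inl (hk y hy hn)
  · exact (exists_near_rlt_left hx hq h).imp fun k hk y hy hn => .inr (hk y hy hn)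

variable {P : M.carrier one → Prop} {x : M.carrier one}

theorem AlphaSet.semiOpen {X : M.carrier one → Prop} (h : M.AlphaSet X P) : M.SemiOpen X P :=
  fun x hx hP => let ⟨_, _, hk⟩ := h x hx hP
    hk x hx (near_self _ x)

/-- A point of the intersection is a limit of interior points of `C`, and those close enough lie in
`O`. This covers both 𝒜- and 𝒜ℬ-sets. -/
theorem SemiOpen.inter {X O C : M.carrier one → Prop} (hO : M.OpenIn X O) (hC : M.SemiOpen X C)
    (h : ∀ x, X x → (P x ↔ O x ∧ C x)) : ∀ x, X x → P x → ∃ y, M.Int X P y := by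
  intro x hx hP
  obtain ⟨hxO, hxC⟩ := (h x hx).1 hP
  obtain ⟨k, hk⟩ := hO x hx hxO
  obtain ⟨-, hcl⟩ := hC x hx hxC
  obtain ⟨y, hy, hxy, -, l, hl⟩ := hcl k
  obtain ⟨m, hm⟩ := hO y hy (hk y hy hxy)
  exact ⟨y, hy, l + m, fun z hz hyz =>
    (h z hz).2 ⟨hm z hz (near_right hyz), hl z hz (near_left hyz)⟩⟩

theorem RegularClosed.semiOpen {X : M.carrier one → Prop} (h : M.RegularClosed X P) :
    M.SemiOpen X P := fun x hx hP => (h x hx).1 hP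

theorem Int.exists_ratReal (h : M.Int M.Unit01 P x) : ∃ r, M.Unit01 (M.ratReal r) ∧ P (M.ratReal r) := by
  obtain ⟨hx, k, hk⟩ := h
  obtain ⟨r, hr, hn⟩ := exists_ratReal_near hx k
  exact ⟨r, hr, hk _ hr hn⟩

/-- If `f x > q` for some `x`, then this holds for some rational `x`. -/
theorem Tame.exists_ratReal {f : M.carrier (arr one one)} (hf : M.Tame f) {q : M.carrier one}
    (hq : M.IsReal q) {x : M.carrier one} (hx : M.Unit01 x) (h : M.rlt q (M.app f x)) :
    ∃ r, M.Unit01 (M.ratReal r) ∧ M.rlt q (M.app f (M.ratReal r)) := by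
  obtain ⟨⟨hreal, -⟩, hf⟩ := hf
  obtain ⟨G, hG, hGq⟩ := exists_isOpenSet_gt hq
  have hxG : M.Preimage f G x := ⟨hx, (hGq _).2 h⟩
  have of_int : (∃ y, M.Int M.Unit01 (M.Preimage f G) y) →
      ∃ r, M.Unit01 (M.ratReal r) ∧ M.rlt q (M.app f (M.ratReal r)) := fun ⟨y, hy⟩ =>
    let ⟨r, hr, _, hr'⟩ := hy.exists_ratReal
    ⟨r, hr, (hGq _).1 hr'⟩
  have of_semiOpen (hs : M.SemiOpen M.Unit01 (M.Preimage f G)) := of_int <| by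
    obtain ⟨y, -, -, hy⟩ := (hs x hx hxG).2 M.zero
    exact ⟨y, hy⟩
  rcases hf with hf | hf | hf | hf | hf | hf | hf
  · exact of_semiOpen (hf G hG).semiOpen
  · exact of_semiOpen (hf G hG)
  · obtain ⟨O, C, -, -, hO, hC, h⟩ := hf G hG
    exact of_int (SemiOpen.inter hO hC.semiOpen h x hx hxG)
  · obtain ⟨O, C, -, -, hO, hC, -, h⟩ := hf G hG
    exact of_int (SemiOpen.inter hO hC h x hx hxG)
  · obtain ⟨k, hk⟩ := exists_near_rlt_right hq (hreal x hx) h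
    -- The neighbourhood is the whole space, with constant characteristic function `1`; only the
    -- closeness of values matters.
    have hU (y) : M.app (M.app (M.combK o one) M.num1) y = M.num1 := hM.out.combK_eq o one _ _
    obtain ⟨a, b, ha, hb, hab, h'⟩ := hf x hx k (M.app (M.combK o one) M.num1)
      ⟨fun y _ => .inr (hU y), fun y z _ _ _ => (hU y).trans (hU z).symm⟩
      (fun y _ _ => ⟨M.zero, fun z _ _ => hU z⟩) (hU x)
    obtain ⟨r, hr, har, hrb⟩ := exists_ratReal_between ha hb hab
    exact ⟨r, hr, hk _ (hreal _ hr) (h' _ hr.1 har hrb).2⟩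
  -- The preimage of the complement of `f x` is closed and does not contain `x`, so nearby rational
  -- points cannot have values below `f x`.
  · obtain ⟨U, hU, hUx⟩ := exists_isOpenSet_ne (hreal x hx)
    obtain ⟨k, hk⟩ := hf U hU x hx fun h => (not_or_intro (not_rlt_self (hreal x hx))
      (not_rlt_self (hreal x hx))) ((hUx _).1 h.2)
    obtain ⟨r, hr, hn⟩ := exists_ratReal_near hx k
    refine ⟨r, hr, rlt_of_rlt_of_rle hq (hreal x hx) (hreal _ hr) h fun h' => ?_⟩
    exact hk _ hr hn ⟨hr, (hUx _).2 (.inr h')⟩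
  · exact of_semiOpen (hf G hG).1

end WeakContinuity

/-! ### The supremum functional -/

section Supremum

variable {M : TypeStructure.{u}} [hM : Fact M.ModelsACA] {α : Type u} [Ctx M α]

theorem exists_lt_toK_mul_tw (x : FracField (M.carrier o)) (m : M.carrier o) :
    ∃ n, x < toK n * tw m := by
  obtain ⟨k, hk⟩ := exists_tw_lt (x := tw m / (1 + |x|)) (div_pos (tw_pos m) (by positivity))
  refine ⟨M.pow2 k, (le_abs_self x).trans_lt ?_⟩
  rw [lt_div_iff₀ (by positivity), tw, inv_mul_lt_iff₀ (toK_pow2_pos k)] at hk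
  linarith

theorem ratVal_add_mul_tw_le_iff {q q' m n : M.carrier o} :
    ratVal q + toK n * tw m ≤ ratVal q' ↔ ∃ r s, M.Codes q r ∧ M.Codes q' s ∧
      ¬ M.flt s (M.fadd r ⟨n, M.zero, M.pow2 m⟩) := by
  refine (exists_codes_and (P' := fun a b => a + toK n * tw m ≤ b) fun r s hr hs => ?_).symm
  have hm : (⟨n, M.zero, M.pow2 m⟩ : M.Frac).den ≠ 0 := pow2_ne_zero m
  rw [flt_iff hs (Frac.den_fadd hr hm), Frac.val_fadd hr hm, not_lt]
  simp [Frac.val, tw, zero_eq, div_eq_mul_inv]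

theorem Dec.ratVal_add_mul_tw_le {F G : α → M.carrier o} {n m : α → M.carrier o} (hF : Rep F)
    (hG : Rep G) (hn : Rep n) (hm : Rep m) :
    Dec (M := M) fun e => ratVal (F e) + toK (n e) * tw (m e) ≤ ratVal (G e) := by
  have h {F : α → M.carrier o} (hF : Rep F) : Rep fun e : M.carrier o × M.carrier o ×
      M.carrier o × M.carrier o × M.carrier o × M.carrier o × α => F e.2.2.2.2.2.2 :=
    hF.weaken.weaken.weaken.weaken.weaken.weaken
  -- Beyond the six numbers of two fractions, `Codes` binds two more and `ltNat` one more.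
  have hF' := (h hF).weaken (σ := o) |>.weaken (σ := o)
  have hG' := (h hG).weaken (σ := o) |>.weaken (σ := o)
  have hn' := (h hn).weaken (σ := o)
  have hm' := (h hm).weaken (σ := o)
  exact Dec.congr (P := fun e => ∃ r s, M.Codes (F e) r ∧ M.Codes (G e) s ∧
    ¬ M.flt s (M.fadd r ⟨n e, M.zero, M.pow2 (m e)⟩)) Dec.of_formula
    fun _ => ratVal_add_mul_tw_le_iff.symm

theorem Dec.unit01_ratReal {F : α → M.carrier o} (hF : Rep F) :
    Dec (M := M) fun e => M.Unit01 (M.ratReal (F e)) := by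
  obtain ⟨q₀, h₀⟩ := exists_ratVal_eq (0 : FracField (M.carrier o))
  obtain ⟨q₁, h₁⟩ := exists_ratVal_eq (1 : FracField (M.carrier o))
  have hF' : Rep fun e => M.ratReal (F e) := .app (.const _) hF
  refine ((Dec.rlt hF' (.const (M.ratReal q₀))).not.and
    (Dec.rlt (.const (M.ratReal q₁)) hF').not).congr fun e => ?_
  rw [rlt_ratReal (isReal_ratReal _), ltRat_ratReal, rlt_ratReal (isReal_ratReal _), ltRat_ratReal,
    h₀, h₁, not_lt, not_lt, TypeStructure.unit01_ratReal]

/-- The rational with code `q` is smaller than some value of `f` at a rational point. -/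
def BelowSup (f : M.carrier (arr one one)) (q : M.carrier o) : Prop :=
  ∃ r, M.Unit01 (M.ratReal r) ∧ M.rlt (M.ratReal q) (M.app f (M.ratReal r))

/-- Restricting to rational points leaves only number quantifiers, with `f` itself as a parameter.
-/
theorem Dec.belowSup {F : α → M.carrier (arr one one)} {Q : α → M.carrier o} (hF : Rep F)
    (hQ : Rep Q) : Dec (M := M) fun e => BelowSup (F e) (Q e) := by
  refine Dec.exists (.and (.unit01_ratReal .fst) (.rlt ?_ ?_))
  · exact .app (.const _) hQ.weaken
  · exact .app hF.weaken (.app (.const _) .fst)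

/-- The rational with code `y` is smaller than the supremum of `f` by less than `2 ^ (-m)`. -/
def SupApprox (f : M.carrier (arr one one)) (m y : M.carrier o) : Prop :=
  BelowSup f y ∧ ∀ q, ratVal y + toK M.num1 * tw m ≤ ratVal q → ¬ BelowSup f q

theorem Dec.supApprox {F : α → M.carrier (arr one one)} {m y : α → M.carrier o} (hF : Rep F)
    (hm : Rep m) (hy : Rep y) : Dec (M := M) fun e => SupApprox (F e) (m e) (y e) :=
  (Dec.belowSup hF hy).and <| Dec.forall <|
    (Dec.ratVal_add_mul_tw_le hy.weaken .fst (.const _) hm.weaken).imp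
      (Dec.belowSup hF.weaken .fst).not

-- A single definable choice, uniform in all `f`: entry `0` tags unboundedness over rational points,
-- and entry `m + 1` is an `m`-th approximation whenever one exists.
variable (M) in
theorem exists_supApprox_functional : ∃ Ξ : M.carrier (arr (arr one one) one), ∀ f,
    ((∀ q, BelowSup f q) → M.app (M.app Ξ f) M.zero = M.num1) ∧
    (¬ (∀ q, BelowSup f q) → M.app (M.app Ξ f) M.zero = M.zero) ∧
    ∀ m y, SupApprox f m y → SupApprox f m (M.app (M.app Ξ f) (M.suc m)) := by
  have hunb : Dec (M := M) fun e : M.carrier o × M.carrier o × M.carrier (arr one one) ×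
      PUnit.{u + 1} => ∀ q, BelowSup e.2.2.1 q :=
    Dec.forall (Dec.belowSup .snd3 .fst)
  have happrox : Dec (M := M) fun e : M.carrier o × M.carrier o × M.carrier (arr one one) ×
      PUnit.{u + 1} => ∀ m, e.2.1 = M.suc m → SupApprox e.2.2.1 m e.1 := by
    refine Dec.forall (.imp (.eq .snd2 ?_) (.supApprox .snd3 .fst .snd1))
    exact .app (.const _) .fst
  have hzero : Dec (M := M) fun e : M.carrier o × M.carrier o × M.carrier (arr one one) ×
      PUnit.{u + 1} => e.2.1 = M.zero := .eq .snd1 (.const _)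
  obtain ⟨F, hF, hF'⟩ := Dec.exists_choice
    (Q := fun (e : M.carrier o × M.carrier (arr one one) × PUnit.{u + 1}) y =>
      (e.1 = M.zero → ((∀ q, BelowSup e.2.1 q) → y = M.num1) ∧
        (¬ (∀ q, BelowSup e.2.1 q) → y = M.zero)) ∧
      ∀ m, e.1 = M.suc m → SupApprox e.2.1 m y)
    (.and (.imp hzero (.and (hunb.imp (.eq .fst (.const _))) (hunb.not.imp (.eq .fst (.const _)))))
      happrox)
  obtain ⟨G, hG, hGF⟩ := hF.curry
  obtain ⟨Ξ, hΞ⟩ := hG.exists_closed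
  have h (f n) : M.app (M.app Ξ f) n = F (n, f, ⟨⟩) := (hΞ f n).trans (hGF n _)
  have h0 (m : M.carrier o) : M.zero ≠ M.suc m := (suc_ne_zero m).symm
  refine ⟨Ξ, fun f => ⟨fun hu => ?_, fun hu => ?_, fun m y hy => ?_⟩⟩
  · rw [h]
    exact ((hF' (M.zero, f, ⟨⟩) M.num1 ⟨fun _ => ⟨fun _ => rfl, fun h => absurd hu h⟩,
      fun m hm => absurd hm (h0 m)⟩).1 rfl).1 hu
  · rw [h]
    exact ((hF' (M.zero, f, ⟨⟩) M.zero ⟨fun _ => ⟨fun h => absurd h hu, fun _ => rfl⟩,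
      fun m hm => absurd hm (h0 m)⟩).1 rfl).2 hu
  · rw [h]
    refine (hF' (M.suc m, f, ⟨⟩) y ⟨fun hm => absurd hm (suc_ne_zero m), fun m' hm => ?_⟩).2 m rfl
    rwa [← suc_inj.1 hm]

theorem toK_num1 : toK M.num1 = 1 := map_one _

variable {f g : M.carrier (arr one one)}

theorem belowSup_iff (hf : M.IsFun01 f) {q : M.carrier o} :
    BelowSup f q ↔ ∃ r, M.Unit01 (M.ratReal r) ∧ RatLT (ratVal q) (M.app f (M.ratReal r)) :=
  exists_congr fun _ => and_congr_right fun hr => ratReal_rlt (hf.1 _ hr)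

theorem BelowSup.mono (hf : M.IsFun01 f) {q q' : M.carrier o} (h : BelowSup f q)
    (hq : ratVal q' ≤ ratVal q) : BelowSup f q' :=
  let ⟨r, hr, h⟩ := (belowSup_iff hf).1 h
  (belowSup_iff hf).2 ⟨r, hr, h.mono hq⟩

theorem exists_belowSup (hf : M.IsFun01 f) : ∃ q, BelowSup f q := by
  obtain ⟨r, hr⟩ := exists_ratVal_eq (0 : FracField (M.carrier o))
  have hr : M.Unit01 (M.ratReal r) := unit01_ratReal.2 (by simp [hr])
  obtain ⟨q, hq⟩ := exists_ratVal_eq (ratVal (M.app (M.app f (M.ratReal r)) 0) - tw 0 - 1)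
  exact ⟨q, (belowSup_iff hf).2 ⟨r, hr, 0, by linarith⟩⟩

/-- Otherwise every rational below the supremum could be raised by `2 ^ (-m)` and stay below.
Starting from `q₀`, enough such steps pass `q₁`. -/
theorem exists_supApprox (hf : M.IsFun01 f) (hb : ¬ ∀ q, BelowSup f q) (m : M.carrier o) :
    ∃ y, SupApprox f m y := by
  by_contra! hno
  obtain ⟨q₀, h₀⟩ := exists_belowSup hf
  obtain ⟨q₁, h₁⟩ := not_forall.1 hb
  have h (n : M.carrier o) : ∃ y, BelowSup f y ∧ ratVal q₀ + toK n * tw m ≤ ratVal y := by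
    induction n using Dec.induction (M := M) with
    -- The number of steps may be nonstandard, so the induction formula has to be arithmetical.
    | hP => exact Dec.exists ((Dec.belowSup (.const _) .fst).and
        (Dec.ratVal_add_mul_tw_le (.const _) .fst .snd1 (.const _)))
    | h0 => exact ⟨q₀, h₀, by simp [zero_eq, toK]⟩
    | hs n ih =>
      obtain ⟨y, hy, hle⟩ := ih
      have hn := hno y
      simp only [SupApprox, hy, true_and, not_forall, not_not] at hn
      obtain ⟨q, hq, hq'⟩ := hn
      refine ⟨q, hq', ?_⟩
      rw [toK_num1] at hq
      rw [suc_eq, toK, map_add, map_one]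
      linarith
  obtain ⟨n, hn⟩ := exists_lt_toK_mul_tw (ratVal q₁ - ratVal q₀) m
  obtain ⟨y, hy, hle⟩ := h n
  exact h₁ (hy.mono hf (by linarith))

/-- Only the precision of `y` enters. With `g = f` this gives fast convergence, and with `f`, `g`
equal on `[0,1]` it gives extensionality of the functional. -/
theorem SupApprox.lt (h : ∀ q, BelowSup g q → BelowSup f q) {m n y z : M.carrier o}
    (hy : SupApprox f m y) (hz : SupApprox g n z) : ratVal z < ratVal y + tw m :=
  not_le.1 fun hle => hy.2 z (by rwa [toK_num1, one_mul]) (h z hz.1)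

theorem app_tail (h : M.carrier one) (n : M.carrier o) :
    M.app (M.tail h) n = M.app h (M.suc n) := by
  refine (hM.out.combS_eq o o o _ _ n).trans ?_
  exact hM.out.combK_eq one o h n _

theorem isReal_tail {h : M.carrier one} (hh : ∀ m, SupApprox f m (M.app h (M.suc m))) :
    M.IsReal (M.tail h) := by
  refine isReal_iff.2 fun n i => ?_
  rw [app_tail, app_tail, abs_lt]
  have h1 := (hh n).lt (fun _ => id) (hh (n + i))
  have h2 := (hh (n + i)).lt (fun _ => id) (hh n)
  have h3 := tw_add_le n i
  constructor <;> linarith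

/-- Weak continuity is used only for the upper bound: a value above the limit would move to a
rational point and contradict an approximation. Leastness holds for every function. -/
theorem Tame.isSup01 (hf : M.Tame f) {h : M.carrier one}
    (h1 : (∀ q, BelowSup f q) → M.app h M.zero = M.num1)
    (h0 : ¬ (∀ q, BelowSup f q) → M.app h M.zero = M.zero)
    (hh : ¬ (∀ q, BelowSup f q) → ∀ m, SupApprox f m (M.app h (M.suc m))) : M.IsSup01 f h := by
  have hf' := hf.1
  have h01 : M.num1 ≠ M.zero := suc_ne_zero M.zero
  by_cases hu : ∀ q, BelowSup f q
  · have h1 := h1 hu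
    refine ⟨.inr (.inl h1), fun x _ => .inl h1, fun z hz _ => ?_⟩
    obtain ⟨q, hq⟩ := exists_ratVal_eq (ratVal (M.app z 0) + tw 0 + 1)
    obtain ⟨r, hr, hqr⟩ := (belowSup_iff hf').1 (hu q)
    exact ⟨_, hr, (rlt_iff_exists hz (hf'.1 _ hr)).2 ⟨_, ⟨0, by linarith⟩, hqr⟩⟩
  · have h0 := h0 hu
    have hh := hh hu
    have ht := isReal_tail hh
    refine ⟨.inl ⟨h0, ht⟩, fun x hx => .inr ⟨h0, fun hlt => ?_⟩, fun z hz hlt => ?_⟩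
    · obtain ⟨r, hr, hlt⟩ := hf.exists_ratReal ht hx hlt
      obtain ⟨c, ⟨n, hn⟩, hc⟩ := (rlt_iff_exists ht (hf'.1 _ hr)).1 hlt
      obtain ⟨q, rfl⟩ := exists_ratVal_eq c
      rw [app_tail] at hn
      exact (hh n).2 q (by rw [toK_num1]; linarith) ((belowSup_iff hf').2 ⟨r, hr, hc⟩)
    · rcases hlt with hlt | ⟨-, hlt⟩
      · exact absurd (hlt.symm.trans h0) h01
      · obtain ⟨c, hc, n, hn⟩ := (rlt_iff_exists hz ht).1 hlt
        rw [app_tail] at hn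
        obtain ⟨r, hr, hqr⟩ := (belowSup_iff hf').1 (hh n).1
        exact ⟨_, hr, (rlt_iff_exists hz (hf'.1 _ hr)).2
          ⟨c, hc, hqr.mono (by linarith [tw_pos n])⟩⟩

theorem belowSup_congr (hf : M.IsFun01 f) (hg : M.IsFun01 g)
    (h : ∀ x, M.Unit01 x → M.req (M.app f x) (M.app g x)) (q : M.carrier o) :
    BelowSup f q ↔ BelowSup g q :=
  exists_congr fun _ => and_congr_right fun hr =>
    rlt_congr (isReal_ratReal q) (hf.1 _ hr) (isReal_ratReal q) (hg.1 _ hr)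
      ⟨not_rlt_self (isReal_ratReal q), not_rlt_self (isReal_ratReal q)⟩ (h _ hr)

theorem rle_tail (h : ∀ q, BelowSup g q → BelowSup f q) {s t : M.carrier one}
    (hs : ∀ m, SupApprox f m (M.app s (M.suc m))) (ht : ∀ m, SupApprox g m (M.app t (M.suc m))) :
    M.rle (M.tail t) (M.tail s) := fun hlt => by
  obtain ⟨n, hn⟩ := rlt_iff.1 hlt
  rw [app_tail, app_tail] at hn
  linarith [(hs n).lt h (ht n), tw_pos n]

-- The functional computes the supremum over rational points for every function, hence is
-- extensional outside the class too; the value `-∞` never occurs.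
variable (M) in
theorem exists_supFunctional : ∃ Ξ, M.IsSupFunctional M.Tame Ξ := by
  obtain ⟨Ξ, hΞ⟩ := exists_supApprox_functional M
  have hh {f} (hf : M.IsFun01 f) (hu : ¬ ∀ q, BelowSup f q) (m) :
      SupApprox f m (M.app (M.app Ξ f) (M.suc m)) :=
    let ⟨y, hy⟩ := exists_supApprox hf hu m
    (hΞ f).2.2 m y hy
  refine ⟨Ξ, ⟨fun f hf => ?_, fun f g hf hg hfg => ?_⟩, fun f hf =>
    hf.isSup01 (hΞ f).1 (hΞ f).2.1 (hh hf.1)⟩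
  · by_cases hu : ∀ q, BelowSup f q
    · exact .inr (.inl ((hΞ f).1 hu))
    · exact .inl ⟨(hΞ f).2.1 hu, isReal_tail (hh hf hu)⟩
  · have hc := belowSup_congr hf hg hfg
    by_cases hu : ∀ q, BelowSup f q
    · have hf1 := (hΞ f).1 hu
      have hg1 := (hΞ g).1 fun q => (hc q).1 (hu q)
      refine ⟨hf1.trans hg1.symm, fun h0 => absurd (hf1.symm.trans h0) (suc_ne_zero _)⟩
    · have hu' : ¬ ∀ q, BelowSup g q := fun h => hu fun q => (hc q).2 (h q)
      exact ⟨((hΞ f).2.1 hu).trans ((hΞ g).2.1 hu').symm, fun _ =>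
        ⟨rle_tail (fun q => (hc q).1) (hh hg hu') (hh hf hu),
          rle_tail (fun q => (hc q).2) (hh hf hu) (hh hg hu')⟩⟩

end Supremum
end TypeStructure

theorem theorem2p7 (M : TypeStructure.{u}) (hM : M.ModelsACA) :
    (∃ Ξ : M.carrier (.arr (.arr .one .one) .one), M.IsSupFunctional M.Tame Ξ) ∧
      ∀ f : M.carrier (.arr .one .one), M.Tame f → ∀ q : M.carrier .one, M.IsReal q →
        ((∃ x, M.Unit01 x ∧ M.rlt q (M.app f x)) ↔
          ∃ r : M.carrier .o, M.Unit01 (M.ratReal r) ∧ M.rlt q (M.app f (M.ratReal r))) := by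
  have : Fact M.ModelsACA := ⟨hM⟩
  exact ⟨TypeStructure.exists_supFunctional M, fun f hf q hq =>
    ⟨fun ⟨_, hx, h⟩ => hf.exists_ratReal hq hx h, fun ⟨r, hr, h⟩ => ⟨_, hr, h⟩⟩⟩
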